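/- Let $\mathbb S^2\subset\mathbb R^3$ be the unit sphere with its surface measure $dp$, let $\eta\in\mathbb R$, and let $\mathcal P(\mathbb S^2)=\{f\in L^1(\mathbb S^2): f\ge 0 \text{ a.e.},\ \int_{\mathbb S^2} f\,dp=1\}$. For $f\in\mathcal P(\mathbb S^2)$ put $$\mathcal F(f)=\int_{\mathbb S^2} f(p)\ln f(p)-f(p)\ln\Big(\int_{\mathbb S^2}\big((p\cdot q)^2-\tfrac13\big)f(q)\,dq-\eta\Big)\,dp\in\mathbb R\cup\{+\infty\},$$ where $-\ln x=+\infty$ for $x\le 0$ and $0\cdot(+\infty)=0$, and let $\mathrm{dom}(\mathcal F)$ be the set of $f\in\mathcal P(\mathbb S^2)$ with $\mathcal F(f)<+\infty$. The Q-tensor of $f\in L^1(\mathbb S^2)$ is the traceless symmetric matrix $\int_{\mathbb S^2}(p\otimes p-\tfrac13 I)f(p)\,dp$. For a traceless symmetric real $3\times3$ matrix $Q$ let $A(Q)$ be the set of $f\in\mathcal P(\mathbb S^2)$ with Q-tensor $Q$, let $J(Q)=\inf_{f\in A(Q)}\mathcal F(f)$ and $E_Q=\{p\in\mathbb S^2: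 Qp\cdot p>\eta\}$, let $\mathrm{dom}(J)$ be the (open) set of $Q$ with $J(Q)<+\infty$, and for $Q\in\mathrm{dom}(J)$ let $f_Q$ be the unique minimiser of $\mathcal F$ on $A(Q)$. A critical point of $J$ is a $Q\in \mathrm{dom}(J)$ at which $J$ is differentiable (on the space of traceless symmetric matrices) with derivative zero. Let $V$ be the space of $u\in L^\infty(\mathbb S^2)$ with $\int_{\mathbb S^2} u\,dp=0$ and zero Q-tensor. A map $t\mapsto f_t$ from $(-\epsilon,\epsilon)$, $\epsilon>0$, to $L^1(\mathbb S^2)$ satisfies (A1) if there are $Q\in C^1((-\epsilon,\epsilon);\mathrm{dom}(J))$ and $u,u_0\in V$ such that (1) $f_t=f_{Q_t}+u_0+tu$ for all $t$; (2) the supports of $u$ and $u_0$ are compact subsets of $E_{Q_0}$; (3) $f_t\in\mathrm{dom}(\mathcal F)$ for all $-\epsilon<t<\epsilon$. **Proposition.** Let $f^*\in\mathrm{dom}(\mathcal F)$ have Q-tensor $Q^*$. Assume that at least one curve satisfying (A1) has $f_0=f^*$ and, in case $E_{Q^*}=\mathbb S^2$, that $f^*>0$ almost everywhere on $\mathbb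 S^2$. Then $$\left.\frac{d}{dt}\mathcal F(f_t)\right|_{t=0}\ \text{ exists and equals } 0$$ for every curve $t\mapsto f_t$ satisfying (A1) with $f_0=f^*$ if and only if $f^*=f_{Q^*}$ (almost everywhere) and $Q^*$ is a critical point of $J$. -/

import Mathlib

open MeasureTheory Set

namespace DenseNematic

noncomputable section

/-- The unit sphere of three-dimensional Euclidean space. -/
abbrev S2 : Type := Metric.sphere (0 : EuclideanSpace ℝ (Fin 3)) 1

/-- The surface measure of the unit sphere (the two-dimensional Hausdorff measure, normalised so
that the sphere has measure `4π`). -/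
def sigma : Measure S2 := (volume : Measure (EuclideanSpace ℝ (Fin 3))).toSphere

/-- Traceless symmetric real `3 × 3` matrices, given by their entries. The norm is the maximum norm
of the entries; only its topology matters below, and all norms on this finite-dimensional space are
equivalent. -/
def Sym0 : Submodule ℝ (Fin 3 → Fin 3 → ℝ) where
  carrier := {Q | (∀ i j, Q i j = Q j i) ∧ ∑ i, Q i i = 0}
  add_mem' := by
    rintro A B ⟨hA, hA'⟩ ⟨hB, hB'⟩
    exact ⟨fun i j => by simp [hA i j, hB i j], by simp [Finset.sum_add_distrib, hA', hB']⟩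
  zero_mem' := ⟨fun _ _ => rfl, by simp⟩
  smul_mem' := by
    rintro c A ⟨hA, hA'⟩
    exact ⟨fun i j => by simp [hA i j], by simp [← Finset.mul_sum, hA']⟩

/-- The quadratic form `Q p · p`. -/
def qForm (Q : Sym0) (p : S2) : ℝ := ∑ i, ∑ j, Q.1 i j * p.1 i * p.1 j

/-- The matrix `p ⊗ p - I / 3`. -/
def qKernel (p : S2) : Sym0 :=
  ⟨fun i j => p.1 i * p.1 j - if i = j then 1 / 3 else 0, by
    constructor
    · intro i j
      simp [eq_comm, mul_comm]
    · have h : ‖p.1‖ = 1 := by simp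
      have h2 := EuclideanSpace.real_norm_sq_eq p.1
      rw [h, Fin.sum_univ_three] at h2
      simp only [Fin.sum_univ_three, if_true]
      nlinarith⟩

/-- The Q-tensor `∫ (p ⊗ p - I / 3) f(p) dp`. -/
def qTensor (f : S2 → ℝ) : Sym0 := ∫ p, f p • qKernel p ∂sigma

/-- Probability densities on the sphere. Functions stand for their classes modulo a.e. equality. -/
def IsDensity (f : S2 → ℝ) : Prop :=
  Integrable f sigma ∧ 0 ≤ᵐ[sigma] f ∧ ∫ p, f p ∂sigma = 1

/-- The field `p ↦ ∫ ((p · q)² - 1 / 3) f(q) dq`. -/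
def meanField (f : S2 → ℝ) (p : S2) : ℝ :=
  ∫ q, ((inner ℝ p.1 q.1) ^ 2 - 1 / 3) * f q ∂sigma

open Classical in
/-- The free energy `∫ f ln f - f ln (∫ ((p · q)² - 1 / 3) f(q) dq - η) dp` of a density `f`, with
`-ln x = +∞` for `x ≤ 0` and `0 · (+∞) = 0`. For a density, the integrand is bounded below by
`-1/e` minus a multiple of `f`, so that its negative part is integrable: the integral is `+∞`
exactly if the integrand is infinite on a set of positive measure, or finite almost everywhere but
not integrable. -/
def freeEnergy (η : ℝ) (f : S2 → ℝ) : EReal :=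
  if (∀ᵐ p ∂sigma, f p ≠ 0 → η < meanField f p) ∧
      Integrable (fun p => f p * Real.log (f p) - f p * Real.log (meanField f p - η)) sigma then
    ((∫ p, (f p * Real.log (f p) - f p * Real.log (meanField f p - η)) ∂sigma : ℝ) : EReal)
  else ⊤

/-- The densities of finite energy. -/
def domF (η : ℝ) : Set (S2 → ℝ) := {f | IsDensity f ∧ freeEnergy η f < ⊤}

/-- The densities with Q-tensor `Q`. -/
def admissible (Q : Sym0) : Set (S2 → ℝ) := {f | IsDensity f ∧ qTensor f = Q}

/-- The macroscopic energy `J(Q) = inf {F(f) : f ∈ A(Q)}`. It is `+∞` if `A(Q)` is empty, which is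
the case for every `Q` whose least eigenvalue is not larger than `-1/3`. -/
def macroEnergy (η : ℝ) (Q : Sym0) : EReal := ⨅ f ∈ admissible Q, freeEnergy η f

/-- The domain of `J`. -/
def domJ (η : ℝ) : Set Sym0 := {Q | macroEnergy η Q < ⊤}

/-- The set `E_Q = {p : Q p · p > η}`. -/
def posSet (η : ℝ) (Q : Sym0) : Set S2 := {p | η < qForm Q p}

/-- `f` minimises the free energy among the densities with Q-tensor `Q`. -/
def IsOptimal (η : ℝ) (Q : Sym0) (f : S2 → ℝ) : Prop :=
  f ∈ admissible Q ∧ ∀ g ∈ admissible Q, freeEnergy η f ≤ freeEnergy η g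

/-- The minimiser `f_Q` of the free energy among the densities with Q-tensor `Q`; for `Q` in the
domain of `J` it exists and is unique up to a.e. equality. -/
def optimal (η : ℝ) (Q : Sym0) : S2 → ℝ := Classical.epsilon (IsOptimal η Q)

/-- The space `V` of bounded functions with zero integral and zero Q-tensor. -/
def InV (u : S2 → ℝ) : Prop :=
  MemLp u ⊤ sigma ∧ qTensor u = 0 ∧ ∫ p, u p ∂sigma = 0

/-- The (essential) support of `u` is a compact subset of `E`. -/
def CompactlySupportedIn (u : S2 → ℝ) (E : Set S2) : Prop :=
  ∃ K : Set S2, IsCompact K ∧ K ⊆ E ∧ ∀ᵐ p ∂sigma, p ∉ K → u p = 0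

/-- Assumption (A1) on a curve `f : (-ε, ε) → L¹(S²)`; values of `f` outside `(-ε, ε)` are
irrelevant. -/
def SatisfiesA1 (η ε : ℝ) (f : ℝ → S2 → ℝ) : Prop :=
  ∃ (Q : ℝ → Sym0) (u₀ u : S2 → ℝ),
    ContDiffOn ℝ 1 Q (Ioo (-ε) ε) ∧ (∀ t ∈ Ioo (-ε) ε, Q t ∈ domJ η) ∧
    InV u₀ ∧ InV u ∧
    (∀ t ∈ Ioo (-ε) ε, f t =ᵐ[sigma] fun p => optimal η (Q t) p + u₀ p + t * u p) ∧
    CompactlySupportedIn u (posSet η (Q 0)) ∧ CompactlySupportedIn u₀ (posSet η (Q 0)) ∧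
    ∀ t ∈ Ioo (-ε) ε, f t ∈ domF η

/-- `Q` is a critical point of `J`: `J` is finite at `Q` and its derivative on the space of
traceless symmetric matrices exists and vanishes at `Q`. -/
def IsCriticalPoint (η : ℝ) (Q : Sym0) : Prop :=
  Q ∈ domJ η ∧ HasFDerivAt (fun R : Sym0 => (macroEnergy η R).toReal) (0 : Sym0 →L[ℝ] ℝ) Q

end

end DenseNematic

/-!
For a density `f` with Q-tensor `Q` the mean field is `p ↦ Q p · p`, so on `A(Q)` the energy is
`∫ f ln f - f ln (Q p · p - η)₊`. The Gibbs inequality shows that any density in `A(Q)` of the form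
`(Q p · p - η)₊ exp (c + Λ p · p)` is the unique minimiser, with energy `c + Λ : Q`, and that
every pair `(c, Λ)` gives a lower bound for `J` at every `Q` (`le_freeEnergy`, `le_macroEnergy`).
Near a point of `dom J` the multiplier `Λ` is found by minimising the dual function
`∫ (Q p · p - η)₊ exp (Λ p · p - Λ : Q) dp`. This is coercive, locally uniformly in `Q`, because a
nonzero quadratic polynomial vanishes on a null set of the sphere only. Hence `f_Q` exists, has
locally bounded parameters (`eventually_exists_gibbs`), and `dom J` is open; inserting the
multipliers of `Q` into the lower bound at `Q'` shows that `J` is locally Lipschitz.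

If `f*` is the minimiser at a critical point `Q*`, then `u₀ = 0` along a curve and
`F(f_{Q_t} + t u) = J(Q_t) + O(t²)`: the term linear in `u` pairs `u ∈ V` with `c + Λ p · p`, and
the quadratic remainder (`energy_expansion`) is controlled because `f_{Q_t}` is bounded below near the
support of `u`, uniformly in `t`.

Conversely, stationarity along the curves with constant Q-tensor makes `ln f* - ln (Q* p · p - η)`
orthogonal to the elements of `V` supported where both logarithms are bounded, so it is of the form
`c + Λ p · p` where `f* > 0` (`exists_gibbs_eq_of_stationary`). If `E_{Q*}` is not the whole sphere,
then by connectedness of the sphere the compact support of `u₀` misses a nonempty open subset of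
`E_{Q*}`; there `f* = f_{Q*}`, which fixes `(c, Λ)`. Once `f* = f_{Q*}`, the curves `f_{Q* + t R}`
show that all directional derivatives of `J` at `Q*` vanish, and for a locally Lipschitz function on
a finite-dimensional space this gives the Fréchet derivative.
-/

namespace DenseNematic

noncomputable section

open Filter Topology

/-! ### Quadratic forms on the sphere and Q-tensors -/

/-- The Frobenius pairing `∑ Aᵢⱼ Bᵢⱼ` on traceless symmetric matrices. -/
def frob : Sym0 →ₗ[ℝ] Sym0 →ₗ[ℝ] ℝ :=
  LinearMap.mk₂ ℝ (fun A B => ∑ i, ∑ j, A.1 i j * B.1 i j)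
    (fun A A' B => by simp [add_mul, Finset.sum_add_distrib])
    (fun c A B => by simp [Finset.mul_sum, mul_assoc])
    (fun A B B' => by simp [mul_add, Finset.sum_add_distrib])
    (fun c A B => by simp [Finset.mul_sum, mul_left_comm])

theorem frob_apply (A B : Sym0) : frob A B = ∑ i, ∑ j, A.1 i j * B.1 i j := rfl

theorem frob_self_eq_zero {A : Sym0} (h : frob A A = 0) : A = 0 := by
  rw [frob_apply, Finset.sum_eq_zero_iff_of_nonneg
    fun i _ => Finset.sum_nonneg fun j _ => mul_self_nonneg _] at h
  ext i j
  have := h i (Finset.mem_univ _)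
  rw [Finset.sum_eq_zero_iff_of_nonneg fun j _ => mul_self_nonneg _] at this
  simpa using this j (Finset.mem_univ _)

theorem eq_of_forall_frob_eq {A B : Sym0} (h : ∀ R, frob R A = frob R B) : A = B := by
  have h1 : frob (A - B) (A - B) = 0 := by
    rw [map_sub (frob (A - B)), h, sub_self]
  exact sub_eq_zero.1 (frob_self_eq_zero h1)

theorem abs_entry_le (A : Sym0) (i j : Fin 3) : |A.1 i j| ≤ ‖A‖ :=
  (norm_le_pi_norm (A.1 i) j).trans (norm_le_pi_norm A.1 i)

theorem abs_coord_le_one (p : S2) (i : Fin 3) : |p.1 i| ≤ 1 := by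
  have h : ‖p.1‖ = 1 := by simp
  have := PiLp.norm_apply_le p.1 i
  rwa [h] at this

theorem sum_coord_mul_self (p : S2) : ∑ i, p.1 i * p.1 i = 1 := by
  have h : ‖p.1‖ = 1 := by simp
  have h2 := EuclideanSpace.real_norm_sq_eq p.1
  rw [h] at h2
  simpa [sq] using h2.symm

theorem qForm_eq_frob (A : Sym0) (p : S2) : qForm A p = frob A (qKernel p) := by
  have hA := A.2.2
  simp only [qForm, frob_apply, qKernel, Fin.sum_univ_three] at hA ⊢
  simp
  linarith

/-- The constant `9` counts the entries, each bounded by the maximum norm. -/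
theorem abs_frob_le (A B : Sym0) : |frob A B| ≤ 9 * ‖A‖ * ‖B‖ := by
  rw [frob_apply]
  calc |∑ i, ∑ j, A.1 i j * B.1 i j| ≤ ∑ i : Fin 3, ∑ j : Fin 3, ‖A‖ * ‖B‖ := by
        refine (Finset.abs_sum_le_sum_abs _ _).trans (Finset.sum_le_sum fun i _ => ?_)
        refine (Finset.abs_sum_le_sum_abs _ _).trans (Finset.sum_le_sum fun j _ => ?_)
        rw [abs_mul]
        exact mul_le_mul (abs_entry_le A i j) (abs_entry_le B i j) (abs_nonneg _) (norm_nonneg _)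
    _ = 9 * ‖A‖ * ‖B‖ := by simp; ring

theorem abs_qForm_le (A : Sym0) (p : S2) : |qForm A p| ≤ 9 * ‖A‖ := by
  rw [qForm]
  calc |∑ i, ∑ j, A.1 i j * p.1 i * p.1 j| ≤ ∑ i : Fin 3, ∑ j : Fin 3, ‖A‖ := by
        refine (Finset.abs_sum_le_sum_abs _ _).trans (Finset.sum_le_sum fun i _ => ?_)
        refine (Finset.abs_sum_le_sum_abs _ _).trans (Finset.sum_le_sum fun j _ => ?_)
        rw [abs_mul, abs_mul]
        calc |A.1 i j| * |p.1 i| * |p.1 j| ≤ ‖A‖ * 1 * 1 := by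
              gcongr
              exacts [abs_entry_le A i j, abs_coord_le_one p i, abs_coord_le_one p j]
          _ = ‖A‖ := by ring
    _ = 9 * ‖A‖ := by simp; ring

theorem qForm_add (A B : Sym0) (p : S2) : qForm (A + B) p = qForm A p + qForm B p := by
  simp [qForm_eq_frob]

theorem qForm_sub (A B : Sym0) (p : S2) : qForm (A - B) p = qForm A p - qForm B p := by
  simp [qForm_eq_frob]

theorem qForm_smul (c : ℝ) (A : Sym0) (p : S2) : qForm (c • A) p = c * qForm A p := by
  simp [qForm_eq_frob]

theorem continuous_entry (i j : Fin 3) : Continuous fun A : Sym0 => A.1 i j :=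
  (continuous_apply j).comp ((continuous_apply i).comp continuous_subtype_val)

theorem continuous_qForm_uncurry : Continuous fun x : Sym0 × S2 => qForm x.1 x.2 := by
  unfold qForm
  refine continuous_finsetSum _ fun i _ => continuous_finsetSum _ fun j _ => ?_
  have h := (continuous_entry i j).comp (continuous_fst (X := Sym0) (Y := S2))
  exact (h.mul (by fun_prop)).mul (by fun_prop)

theorem continuous_qForm (A : Sym0) : Continuous (qForm A) :=
  continuous_qForm_uncurry.comp (Continuous.prodMk_right A)

theorem continuous_frob_uncurry : Continuous fun x : Sym0 × Sym0 => frob x.1 x.2 := by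
  simp only [frob_apply]
  exact continuous_finsetSum _ fun i _ => continuous_finsetSum _ fun j _ =>
    ((continuous_entry i j).comp continuous_fst).mul ((continuous_entry i j).comp continuous_snd)

theorem continuous_qKernel : Continuous qKernel := by
  unfold qKernel
  refine Continuous.subtype_mk ?_ _
  fun_prop

instance : IsFiniteMeasure sigma := by unfold sigma; infer_instance

instance : sigma.IsOpenPosMeasure := by unfold sigma; infer_instance

theorem integrable_smul_qKernel {f : S2 → ℝ} (hf : Integrable f sigma) :
    Integrable (fun p => f p • qKernel p) sigma := by
  obtain ⟨C, hC⟩ := (isCompact_univ (X := S2)).exists_bound_of_continuousOn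
    continuous_qKernel.continuousOn
  exact hf.smul_bdd C continuous_qKernel.aestronglyMeasurable
    (.of_forall fun p => hC p (mem_univ _))

theorem integrable_mul_qForm {f : S2 → ℝ} (hf : Integrable f sigma) (A : Sym0) :
    Integrable (fun p => f p * qForm A p) sigma :=
  hf.mul_bdd (c := 9 * ‖A‖) (continuous_qForm A).aestronglyMeasurable
    (.of_forall fun p => abs_qForm_le A p)

/-- Testing a Q-tensor against a matrix amounts to integrating the quadratic form of the matrix. -/
theorem frob_qTensor {f : S2 → ℝ} (hf : Integrable f sigma) (A : Sym0) :
    frob A (qTensor f) = ∫ p, f p * qForm A p ∂sigma := by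
  have := (LinearMap.toContinuousLinearMap (frob A)).integral_comp_comm (integrable_smul_qKernel hf)
  simp only [LinearMap.coe_toContinuousLinearMap', map_smul, smul_eq_mul, ← qForm_eq_frob] at this
  exact this.symm

theorem frob_comm (A B : Sym0) : frob A B = frob B A := by
  simp [frob_apply, mul_comm]

/-- The mean field of `f` is the quadratic form of its Q-tensor. -/
theorem meanField_eq_qForm {f : S2 → ℝ} (hf : Integrable f sigma) (p : S2) :
    meanField f p = qForm (qTensor f) p := by
  rw [qForm_eq_frob, frob_comm, frob_qTensor hf, meanField]
  refine integral_congr_ae (.of_forall fun q => ?_)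
  have hp := sum_coord_mul_self p
  have hq := sum_coord_mul_self q
  have h : qForm (qKernel p) q = (inner ℝ p.1 q.1) ^ 2 - 1 / 3 := by
    simp only [qForm, qKernel, PiLp.inner_apply, Fin.sum_univ_three] at hp hq ⊢
    simp
    linear_combination (-1 / 3 : ℝ) * hq
  simp only [h]
  ring

theorem qTensor_congr {f g : S2 → ℝ} (h : f =ᵐ[sigma] g) : qTensor f = qTensor g :=
  integral_congr_ae (h.mono fun p hp => by simp only [hp])

theorem qTensor_add {f g : S2 → ℝ} (hf : Integrable f sigma) (hg : Integrable g sigma) :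
    qTensor (fun p => f p + g p) = qTensor f + qTensor g := by
  rw [qTensor, qTensor, qTensor,
    ← integral_add (integrable_smul_qKernel hf) (integrable_smul_qKernel hg)]
  simp only [add_smul]

theorem qTensor_const_mul (c : ℝ) (f : S2 → ℝ) : qTensor (fun p => c * f p) = c • qTensor f := by
  rw [qTensor, qTensor, ← integral_smul]
  simp only [mul_smul]

theorem freeEnergy_congr {η : ℝ} {f g : S2 → ℝ} (h : f =ᵐ[sigma] g) :
    freeEnergy η f = freeEnergy η g := by
  have hm : meanField f = meanField g := by
    funext p
    exact integral_congr_ae (h.mono fun q hq => by simp only [hq])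
  have h1 : (fun p => f p * Real.log (f p) - f p * Real.log (meanField f p - η)) =ᵐ[sigma]
      fun p => g p * Real.log (g p) - g p * Real.log (meanField g p - η) := by
    filter_upwards [h] with p hp
    rw [hm, hp]
  have h2 : (∀ᵐ p ∂sigma, f p ≠ 0 → η < meanField f p) ↔
      ∀ᵐ p ∂sigma, g p ≠ 0 → η < meanField g p := by
    refine Filter.eventually_congr ?_
    filter_upwards [h] with p hp
    rw [hm, hp]
  unfold freeEnergy
  rw [integral_congr_ae h1, integrable_congr h1, h2]

theorem IsDensity.congr {f g : S2 → ℝ} (hf : IsDensity f) (h : f =ᵐ[sigma] g) : IsDensity g :=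
  ⟨hf.1.congr h, hf.2.1.trans h.le, by rw [← integral_congr_ae h, hf.2.2]⟩

theorem domF_congr {η : ℝ} {f g : S2 → ℝ} (hf : f ∈ domF η) (h : f =ᵐ[sigma] g) : g ∈ domF η :=
  ⟨hf.1.congr h, by rw [← freeEnergy_congr h]; exact hf.2⟩

/-- A nonzero quadratic polynomial `a |x|² + R x · x` on the sphere vanishes on a null set only:
its zero set in space meets every line in the direction of some vector in at most two points. -/
theorem ae_add_qForm_ne_zero {a : ℝ} {R : Sym0} (h : ¬(a = 0 ∧ R = 0)) :
    ∀ᵐ p ∂sigma, a + qForm R p ≠ 0 := by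
  set M : Fin 3 → Fin 3 → ℝ := fun i j => R.1 i j + if i = j then a else 0 with hM
  set P : EuclideanSpace ℝ (Fin 3) → ℝ := fun x => ∑ i, ∑ j, M i j * x i * x j with hP
  have hsymm : ∀ i j, M i j = M j i := fun i j => by simp [hM, R.2.1 i j, eq_comm]
  -- By polarisation, a quadratic form without nonzero values has zero matrix.
  obtain ⟨v, hv⟩ : ∃ v, P v ≠ 0 := by
    by_contra! hall
    have hdiag : ∀ i, M i i = 0 := fun i => by
      have := hall (EuclideanSpace.single i 1)
      simpa [hP, Pi.single_apply] using this
    have hoff : ∀ i j, M i j = 0 := fun i j => by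
      have := hall (EuclideanSpace.single i 1 + EuclideanSpace.single j 1)
      simp [hP, mul_add, Finset.sum_add_distrib, hdiag] at this
      linarith [hsymm i j]
    have ha : a = 0 := by
      have ht := R.2.2
      have h0 := hdiag 0
      have h1 := hdiag 1
      have h2 := hdiag 2
      simp [hM, Fin.sum_univ_three] at ht h0 h1 h2
      linarith
    refine h ⟨ha, ?_⟩
    ext i j
    simpa [hM, ha] using hoff i j
  have hPc : Continuous P := by fun_prop
  have hae : ∀ᵐ x : EuclideanSpace ℝ (Fin 3), x ∈ {x | P x ≠ 0} := by
    refine ae_mem_of_ae_add_linearMap_mem (LinearMap.toSpanSingleton ℝ _ v) (volume : Measure ℝ)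
      volume (isOpen_ne_fun hPc continuous_const).measurableSet fun y => ?_
    -- On the line through `y` the form is a quadratic polynomial with leading coefficient `P v`.
    set B : ℝ := ∑ i, ∑ j, M i j * (y i * v j + v i * y j)
    set q : Polynomial ℝ := .C (P y) + .C B * .X + .C (P v) * .X ^ 2 with hq
    have hq0 : q ≠ 0 := fun h0 => hv (by
      have := congrArg (fun r => r.coeff 2) h0
      simpa [hq, Polynomial.coeff_X, Polynomial.coeff_C] using this)
    have hfin : {t | q.IsRoot t}.Finite := Polynomial.finite_setOfPred_isRoot hq0
    filter_upwards [hfin.countable.ae_notMem volume] with t ht h0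
    apply ht
    have hexp : P (y + t • v) = P y + B * t + P v * t ^ 2 := by
      simp only [hP, B, Finset.sum_mul, ← Finset.sum_add_distrib]
      refine Finset.sum_congr rfl fun i _ => Finset.sum_congr rfl fun j _ => ?_
      simp
      ring
    simp only [LinearMap.toSpanSingleton_apply, hexp] at h0
    simpa [hq, Polynomial.IsRoot] using h0
  have hnull : volume {x | P x = 0} = 0 := by simpa [ae_iff] using hae
  have hmeas : MeasurableSet {p : S2 | a + qForm R p = 0} :=
    (isClosed_eq (continuous_const.add (continuous_qForm R)) continuous_const).measurableSet
  have : sigma {p : S2 | a + qForm R p = 0} = 0 := by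
    rw [sigma, Measure.toSphere_apply' _ hmeas, mul_eq_zero]
    -- The cone over the zero set lies in the zero set of `P`, as `P` is homogeneous.
    refine Or.inr (measure_mono_null ?_ hnull)
    rintro _ ⟨r, -, _, ⟨p, hp, rfl⟩, rfl⟩
    have h1 : P p.1 = a + qForm R p := by
      have h1 := sum_coord_mul_self p
      simp only [hP, hM, qForm, Fin.sum_univ_three] at h1 ⊢
      simp
      linear_combination a * h1
    have h2 : P (r • p.1) = r ^ 2 * P p.1 := by
      simp only [hP, Finset.mul_sum]
      refine Finset.sum_congr rfl fun i _ => Finset.sum_congr rfl fun j _ => ?_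
      simp
      ring
    change P (r • p.1) = 0
    rw [h2, h1, hp, mul_zero]
  simpa [ae_iff] using this

/-! ### The exponential family and weak duality -/

/-- The weight `(Q p · p - η)₊`, positive exactly on `E_Q`. -/
def weight (η : ℝ) (Q : Sym0) (p : S2) : ℝ := max (qForm Q p - η) 0

/-- The exponential family `(Q p · p - η)₊ exp (c + Λ p · p)`. The constant `c` takes the place of
the logarithm of the normalising factor, so that this is a density only for suitable `c`. -/
def gibbs (η : ℝ) (Q : Sym0) (c : ℝ) (Λ : Sym0) (p : S2) : ℝ :=
  weight η Q p * Real.exp (c + qForm Λ p)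

/-- The integrand of the free energy of `f`, when `f` has Q-tensor `Q`. -/
def energyDensity (η : ℝ) (Q : Sym0) (f : S2 → ℝ) (p : S2) : ℝ :=
  f p * Real.log (f p) - f p * Real.log (weight η Q p)

theorem weight_nonneg (η : ℝ) (Q : Sym0) (p : S2) : 0 ≤ weight η Q p := le_max_right _ _

theorem weight_pos_iff {η : ℝ} {Q : Sym0} {p : S2} : 0 < weight η Q p ↔ p ∈ posSet η Q := by
  simp [weight, posSet]

theorem weight_of_mem {η : ℝ} {Q : Sym0} {p : S2} (h : p ∈ posSet η Q) :
    weight η Q p = qForm Q p - η := max_eq_left (sub_nonneg.2 (le_of_lt h))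

theorem weight_le (η : ℝ) (Q : Sym0) (p : S2) : weight η Q p ≤ 9 * ‖Q‖ + |η| :=
  max_le (by linarith [le_of_abs_le (abs_qForm_le Q p), neg_abs_le η]) (by positivity)

theorem abs_weight_sub_le (η : ℝ) (Q Q' : Sym0) (p : S2) :
    |weight η Q p - weight η Q' p| ≤ 9 * ‖Q - Q'‖ := by
  refine (abs_max_sub_max_le_abs _ _ _).trans ?_
  rw [sub_sub_sub_cancel_right, ← qForm_sub]
  exact abs_qForm_le _ p

theorem continuous_weight_uncurry (η : ℝ) : Continuous fun x : Sym0 × S2 => weight η x.1 x.2 :=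
  (continuous_qForm_uncurry.sub continuous_const).max continuous_const

theorem continuous_weight (η : ℝ) (Q : Sym0) : Continuous (weight η Q) :=
  (continuous_weight_uncurry η).comp (Continuous.prodMk_right Q)

theorem isOpen_posSet (η : ℝ) (Q : Sym0) : IsOpen (posSet η Q) :=
  isOpen_lt continuous_const (continuous_qForm Q)

theorem continuous_gibbs (η : ℝ) (Q : Sym0) (c : ℝ) (Λ : Sym0) : Continuous (gibbs η Q c Λ) :=
  (continuous_weight η Q).mul (Real.continuous_exp.comp (continuous_const.add (continuous_qForm Λ)))

theorem _root_.Continuous.integrable_sigma {f : S2 → ℝ} (hf : Continuous f) :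
    Integrable f sigma :=
  hf.integrable_of_hasCompactSupport (HasCompactSupport.of_compactSpace f)

theorem gibbs_nonneg (η : ℝ) (Q : Sym0) (c : ℝ) (Λ : Sym0) (p : S2) : 0 ≤ gibbs η Q c Λ p :=
  mul_nonneg (weight_nonneg _ _ _) (Real.exp_pos _).le

theorem gibbs_pos_iff {η : ℝ} {Q : Sym0} {c : ℝ} {Λ : Sym0} {p : S2} :
    0 < gibbs η Q c Λ p ↔ p ∈ posSet η Q := by
  rw [gibbs, mul_pos_iff_of_pos_right (Real.exp_pos _), weight_pos_iff]

theorem log_gibbs {η : ℝ} {Q : Sym0} {c : ℝ} {Λ : Sym0} {p : S2} (hp : p ∈ posSet η Q) :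
    Real.log (gibbs η Q c Λ p) = Real.log (weight η Q p) + (c + qForm Λ p) := by
  rw [gibbs, Real.log_mul (weight_pos_iff.2 hp).ne' (Real.exp_pos _).ne', Real.log_exp]

theorem energyDensity_gibbs (η : ℝ) (Q : Sym0) (c : ℝ) (Λ : Sym0) (p : S2) :
    energyDensity η Q (gibbs η Q c Λ) p = gibbs η Q c Λ p * (c + qForm Λ p) := by
  by_cases hp : p ∈ posSet η Q
  · rw [energyDensity, log_gibbs hp]
    ring
  · have h0 : gibbs η Q c Λ p = 0 :=
      le_antisymm (not_lt.1 (mt gibbs_pos_iff.1 hp)) (gibbs_nonneg _ _ _ _ _)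
    simp [energyDensity, h0]

theorem energyDensity_ae_eq {η : ℝ} {Q : Sym0} {f : S2 → ℝ} (hf : f ∈ admissible Q)
    (hs : ∀ᵐ p ∂sigma, f p ≠ 0 → p ∈ posSet η Q) :
    (fun p => f p * Real.log (f p) - f p * Real.log (meanField f p - η)) =ᵐ[sigma]
      energyDensity η Q f := by
  filter_upwards [hs] with p hp
  by_cases h : f p = 0
  · simp [energyDensity, h]
  · rw [energyDensity, weight_of_mem (hp h), meanField_eq_qForm hf.1.1, hf.2]

theorem meanField_support_iff {η : ℝ} {Q : Sym0} {f : S2 → ℝ} (hf : f ∈ admissible Q) :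
    (∀ᵐ p ∂sigma, f p ≠ 0 → η < meanField f p) ↔ ∀ᵐ p ∂sigma, f p ≠ 0 → p ∈ posSet η Q := by
  simp only [meanField_eq_qForm hf.1.1, hf.2, posSet, mem_ofPred_eq]

theorem freeEnergy_eq_integral {η : ℝ} {Q : Sym0} {f : S2 → ℝ} (hf : f ∈ admissible Q)
    (hs : ∀ᵐ p ∂sigma, f p ≠ 0 → p ∈ posSet η Q) (hi : Integrable (energyDensity η Q f) sigma) :
    freeEnergy η f = ((∫ p, energyDensity η Q f p ∂sigma : ℝ) : EReal) := by
  have h := energyDensity_ae_eq hf hs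
  rw [freeEnergy, if_pos ⟨(meanField_support_iff hf).2 hs, hi.congr h.symm⟩, integral_congr_ae h]

theorem support_integrable_of_lt_top {η : ℝ} {Q : Sym0} {f : S2 → ℝ} (hf : f ∈ admissible Q)
    (h : freeEnergy η f < ⊤) : (∀ᵐ p ∂sigma, f p ≠ 0 → p ∈ posSet η Q) ∧
      Integrable (energyDensity η Q f) sigma := by
  rw [freeEnergy] at h
  split_ifs at h with hc
  · have hs := (meanField_support_iff hf).1 hc.1
    exact ⟨hs, hc.2.congr (energyDensity_ae_eq hf hs)⟩
  · exact absurd h (lt_irrefl _)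

/-- The pointwise form of the Gibbs inequality, with its equality case. -/
theorem gibbs_inequality {a w : ℝ} (ha : 0 ≤ a) (hw : 0 < w) (s : ℝ) :
    0 ≤ a * Real.log a - a * Real.log w - a * s - a + w * Real.exp s ∧
      (a * Real.log a - a * Real.log w - a * s - a + w * Real.exp s = 0 → a = w * Real.exp s) := by
  have hb : 0 < w * Real.exp s := mul_pos hw (Real.exp_pos s)
  rcases ha.eq_or_lt with rfl | ha
  · simp only [zero_mul, sub_zero, zero_add]
    exact ⟨hb.le, fun h => h.symm⟩
  · have hlog : Real.log (w * Real.exp s / a) = Real.log w + s - Real.log a := by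
      rw [Real.log_div hb.ne' ha.ne', Real.log_mul hw.ne' (Real.exp_pos s).ne', Real.log_exp]
    have hx : 0 < w * Real.exp s / a := by positivity
    have hax : a * (w * Real.exp s / a) = w * Real.exp s := by field_simp
    constructor
    · nlinarith [Real.log_le_sub_one_of_pos hx]
    · intro h
      by_contra hne
      have h1 : w * Real.exp s / a ≠ 1 := fun h1 => hne ((div_eq_one_iff_eq ha.ne').1 h1).symm
      nlinarith [Real.log_lt_sub_one_of_pos hx h1]

/-- The relative entropy density of `f` with respect to `gibbs η Q c Λ`; the last two terms make it
nonnegative pointwise. -/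
def relEntropyDensity (η : ℝ) (Q : Sym0) (c : ℝ) (Λ : Sym0) (f : S2 → ℝ) (p : S2) : ℝ :=
  energyDensity η Q f p - f p * (c + qForm Λ p) - f p + gibbs η Q c Λ p

theorem relEntropyDensity_nonneg_and {η : ℝ} {Q : Sym0} (c : ℝ) (Λ : Sym0) {f : S2 → ℝ}
    (hf : f ∈ admissible Q) (hs : ∀ᵐ p ∂sigma, f p ≠ 0 → p ∈ posSet η Q) :
    ∀ᵐ p ∂sigma, 0 ≤ relEntropyDensity η Q c Λ f p ∧
      (relEntropyDensity η Q c Λ f p = 0 → f p = gibbs η Q c Λ p) := by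
  filter_upwards [hs, hf.1.2.1] with p hp hp0
  by_cases hpE : p ∈ posSet η Q
  · exact gibbs_inequality hp0 (weight_pos_iff.2 hpE) _
  · have h0 : f p = 0 := by_contra fun h => hpE (hp h)
    simp only [relEntropyDensity, energyDensity, h0, zero_mul, sub_zero, zero_add]
    exact ⟨gibbs_nonneg _ _ _ _ _, fun h => h.symm⟩

theorem integrable_mul_add_qForm {f : S2 → ℝ} (hf : Integrable f sigma) (c : ℝ) (Λ : Sym0) :
    Integrable (fun p => f p * (c + qForm Λ p)) sigma := by
  simp only [mul_add]
  exact (hf.mul_const c).add (integrable_mul_qForm hf Λ)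

theorem integral_mul_add_qForm {f : S2 → ℝ} (hf : Integrable f sigma) (c : ℝ) (Λ : Sym0) :
    ∫ p, f p * (c + qForm Λ p) ∂sigma = c * ∫ p, f p ∂sigma + frob Λ (qTensor f) := by
  rw [frob_qTensor hf]
  simp only [mul_add]
  rw [integral_add (hf.mul_const c) (integrable_mul_qForm hf Λ), integral_mul_const, mul_comm]

theorem integrable_relEntropyDensity {η : ℝ} {Q : Sym0} (c : ℝ) (Λ : Sym0) {f : S2 → ℝ}
    (hf : Integrable f sigma) (hi : Integrable (energyDensity η Q f) sigma) :
    Integrable (relEntropyDensity η Q c Λ f) sigma :=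
  ((hi.sub (integrable_mul_add_qForm hf c Λ)).sub hf).add
    (continuous_gibbs η Q c Λ).integrable_sigma

theorem integral_relEntropyDensity {η : ℝ} {Q : Sym0} (c : ℝ) (Λ : Sym0) {f : S2 → ℝ}
    (hf : f ∈ admissible Q) (hi : Integrable (energyDensity η Q f) sigma) :
    ∫ p, relEntropyDensity η Q c Λ f p ∂sigma = ∫ p, energyDensity η Q f p ∂sigma -
      (c + frob Λ Q) - 1 + ∫ p, gibbs η Q c Λ p ∂sigma := by
  have h1 := integrable_mul_add_qForm hf.1.1 c Λ
  have h2 := hi.sub h1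
  have h3 := h2.sub hf.1.1
  have h4 := integral_add h3 (continuous_gibbs η Q c Λ).integrable_sigma
  simp only [Pi.sub_apply] at h4
  have h5 := integral_sub h2 hf.1.1
  simp only [Pi.sub_apply] at h5
  unfold relEntropyDensity
  rw [h4, h5, integral_sub hi h1, integral_mul_add_qForm hf.1.1, hf.1.2.2, hf.2, mul_one]

/-- Weak duality: by integrating the Gibbs inequality, every `c` and `Λ` give a lower bound for the
energy on `A(Q)`. -/
theorem le_freeEnergy {η : ℝ} {Q : Sym0} (c : ℝ) (Λ : Sym0) {f : S2 → ℝ} (hf : f ∈ admissible Q) :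
    ((c + frob Λ Q + 1 - ∫ p, gibbs η Q c Λ p ∂sigma : ℝ) : EReal) ≤ freeEnergy η f := by
  rcases eq_or_ne (freeEnergy η f) ⊤ with h | h
  · rw [h]
    exact le_top
  · obtain ⟨hs, hi⟩ := support_integrable_of_lt_top hf h.lt_top
    rw [freeEnergy_eq_integral hf hs hi, EReal.coe_le_coe_iff]
    have h0 := integral_nonneg_of_ae
      ((relEntropyDensity_nonneg_and (η := η) c Λ hf hs).mono fun p hp => hp.1)
    rw [integral_relEntropyDensity c Λ hf hi] at h0
    linarith

theorem gibbs_support (η : ℝ) (Q : Sym0) (c : ℝ) (Λ : Sym0) :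
    ∀ᵐ p ∂sigma, gibbs η Q c Λ p ≠ 0 → p ∈ posSet η Q :=
  .of_forall fun _ hp => gibbs_pos_iff.1 ((gibbs_nonneg _ _ _ _ _).lt_of_ne' hp)

theorem freeEnergy_gibbs {η : ℝ} {Q : Sym0} {c : ℝ} {Λ : Sym0}
    (hg : gibbs η Q c Λ ∈ admissible Q) :
    freeEnergy η (gibbs η Q c Λ) = ((c + frob Λ Q : ℝ) : EReal) := by
  have he : energyDensity η Q (gibbs η Q c Λ) = fun p => gibbs η Q c Λ p * (c + qForm Λ p) :=
    funext (energyDensity_gibbs η Q c Λ)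
  rw [freeEnergy_eq_integral hg (gibbs_support η Q c Λ)
    (he ▸ integrable_mul_add_qForm hg.1.1 c Λ), he, integral_mul_add_qForm hg.1.1, hg.1.2.2, hg.2,
    mul_one]

/-- A member of the exponential family with Q-tensor `Q` minimises the energy on `A(Q)`. -/
theorem isOptimal_gibbs {η : ℝ} {Q : Sym0} {c : ℝ} {Λ : Sym0}
    (hg : gibbs η Q c Λ ∈ admissible Q) : IsOptimal η Q (gibbs η Q c Λ) := by
  refine ⟨hg, fun f hf => ?_⟩
  have := le_freeEnergy (η := η) c Λ hf
  rwa [hg.1.2.2, add_sub_cancel_right, ← freeEnergy_gibbs hg] at this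

/-- The equality case of the Gibbs inequality makes the minimiser unique. -/
theorem IsOptimal.ae_eq_gibbs {η : ℝ} {Q : Sym0} {c : ℝ} {Λ : Sym0} {f : S2 → ℝ}
    (hf : IsOptimal η Q f) (hg : gibbs η Q c Λ ∈ admissible Q) : f =ᵐ[sigma] gibbs η Q c Λ := by
  have hle := hf.2 _ hg
  have heq := le_antisymm hle ((isOptimal_gibbs hg).2 _ hf.1)
  rw [freeEnergy_gibbs hg] at heq
  obtain ⟨hs, hi⟩ := support_integrable_of_lt_top hf.1 (heq ▸ EReal.coe_lt_top _)
  rw [freeEnergy_eq_integral hf.1 hs hi, EReal.coe_eq_coe_iff] at heq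
  have h0 := integral_relEntropyDensity c Λ hf.1 hi
  rw [heq, hg.1.2.2, sub_self, zero_sub, neg_add_cancel] at h0
  have hnn := relEntropyDensity_nonneg_and (η := η) c Λ hf.1 hs
  have hz := (integral_eq_zero_iff_of_nonneg_ae (hnn.mono fun p hp => hp.1)
    (integrable_relEntropyDensity c Λ hf.1.1.1 hi)).1 h0
  filter_upwards [hnn, hz] with p hp hp0 using hp.2 hp0

theorem optimal_ae_eq_gibbs {η : ℝ} {Q : Sym0} {c : ℝ} {Λ : Sym0}
    (hg : gibbs η Q c Λ ∈ admissible Q) : optimal η Q =ᵐ[sigma] gibbs η Q c Λ :=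
  IsOptimal.ae_eq_gibbs (Classical.epsilon_spec ⟨_, isOptimal_gibbs hg⟩) hg

theorem macroEnergy_eq_of_isOptimal {η : ℝ} {Q : Sym0} {f : S2 → ℝ} (hf : IsOptimal η Q f) :
    macroEnergy η Q = freeEnergy η f :=
  le_antisymm (iInf₂_le f hf.1) (le_iInf₂ hf.2)

theorem macroEnergy_eq_of_gibbs {η : ℝ} {Q : Sym0} {c : ℝ} {Λ : Sym0}
    (hg : gibbs η Q c Λ ∈ admissible Q) : macroEnergy η Q = ((c + frob Λ Q : ℝ) : EReal) := by
  rw [macroEnergy_eq_of_isOptimal (isOptimal_gibbs hg), freeEnergy_gibbs hg]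

theorem le_macroEnergy {η : ℝ} (Q : Sym0) (c : ℝ) (Λ : Sym0) :
    ((c + frob Λ Q + 1 - ∫ p, gibbs η Q c Λ p ∂sigma : ℝ) : EReal) ≤ macroEnergy η Q :=
  le_iInf₂ fun _ hf => le_freeEnergy c Λ hf

theorem exists_of_mem_domJ {η : ℝ} {Q : Sym0} (h : Q ∈ domJ η) :
    ∃ f ∈ admissible Q, freeEnergy η f < ⊤ := by
  have h : ⨅ f ∈ admissible Q, freeEnergy η f < ⊤ := h
  simpa [iInf_lt_iff] using h

/-! ### Existence of the minimisers, with locally bounded multipliers -/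

/-- The dual function `Λ ↦ ∫ (Q p · p - η)₊ exp (Λ p · p - Λ : Q)`, whose minimiser is the Lagrange
multiplier of the constraint that the Q-tensor be `Q`. -/
def dualFun (η : ℝ) (Q Λ : Sym0) : ℝ :=
  ∫ p, weight η Q p * Real.exp (qForm Λ p - frob Λ Q) ∂sigma

/-- A positively homogeneous lower bound for the dual function; its positivity for `Λ ≠ 0` says that
`Q` is an interior point of the convex hull of the `p ⊗ p - I / 3` with `p ∈ E_Q`. -/
def excess (η : ℝ) (Q Λ : Sym0) : ℝ :=
  ∫ p, weight η Q p * max (qForm Λ p - frob Λ Q) 0 ∂sigma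

theorem continuous_integral_sigma {X : Type*} [TopologicalSpace X] [FirstCountableTopology X]
    [LocallyCompactSpace X] {f : X → S2 → ℝ} (hf : Continuous f.uncurry) :
    Continuous fun x => ∫ p, f x p ∂sigma := by
  simpa using continuous_parametric_integral_of_continuous (μ := sigma) hf isCompact_univ

theorem continuous_tilt : Continuous fun x : (Sym0 × Sym0) × S2 =>
    qForm x.1.2 x.2 - frob x.1.2 x.1.1 :=
  (continuous_qForm_uncurry.comp ((continuous_snd.comp continuous_fst).prodMk continuous_snd)).sub
    (continuous_frob_uncurry.comp
      ((continuous_snd.comp continuous_fst).prodMk (continuous_fst.comp continuous_fst)))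

theorem continuous_weight_triple (η : ℝ) : Continuous fun x : (Sym0 × Sym0) × S2 =>
    weight η x.1.1 x.2 := by
  have h : Continuous fun x : (Sym0 × Sym0) × S2 => (x.1.1, x.2) := by fun_prop
  exact ((continuous_qForm_uncurry.comp h).sub continuous_const).max continuous_const

theorem continuous_excess (η : ℝ) : Continuous fun x : Sym0 × Sym0 => excess η x.1 x.2 :=
  continuous_integral_sigma ((continuous_weight_triple η).mul (continuous_tilt.max continuous_const))

theorem continuous_dualFun (η : ℝ) : Continuous fun x : Sym0 × Sym0 => dualFun η x.1 x.2 :=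
  continuous_integral_sigma
    ((continuous_weight_triple η).mul (Real.continuous_exp.comp continuous_tilt))

theorem continuous_tilt_right (Λ Q : Sym0) : Continuous fun p => qForm Λ p - frob Λ Q :=
  (continuous_qForm Λ).sub continuous_const

theorem excess_le_dualFun (η : ℝ) (Q Λ : Sym0) : excess η Q Λ ≤ dualFun η Q Λ := by
  refine integral_mono (Continuous.integrable_sigma ?_) (Continuous.integrable_sigma ?_) fun p => ?_
  · exact (continuous_weight η Q).mul ((continuous_tilt_right Λ Q).max continuous_const)
  · exact (continuous_weight η Q).mul (Real.continuous_exp.comp (continuous_tilt_right Λ Q))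
  · refine mul_le_mul_of_nonneg_left (max_le ?_ (Real.exp_pos _).le) (weight_nonneg _ _ _)
    linarith [Real.add_one_le_exp (qForm Λ p - frob Λ Q)]

theorem excess_smul (η : ℝ) (Q Λ : Sym0) {r : ℝ} (hr : 0 ≤ r) :
    excess η Q (r • Λ) = r * excess η Q Λ := by
  rw [excess, excess, ← integral_const_mul]
  refine integral_congr_ae (.of_forall fun p => ?_)
  have h : max (qForm (r • Λ) p - frob (r • Λ) Q) 0 = r * max (qForm Λ p - frob Λ Q) 0 := by
    rw [mul_max_of_nonneg _ _ hr, mul_zero, qForm_smul, map_smul, LinearMap.smul_apply, smul_eq_mul,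
      mul_sub]
  simp only [h]
  ring

/-- A density with Q-tensor `Q` supported in `E_Q` prevents `Λ p · p ≤ Λ : Q` on all of `E_Q`, as
equality would then hold wherever the density is positive. -/
theorem excess_pos {η : ℝ} {Q Λ : Sym0} (hQ : Q ∈ domJ η) (hΛ : Λ ≠ 0) : 0 < excess η Q Λ := by
  obtain ⟨f, hf, hfin⟩ := exists_of_mem_domJ hQ
  obtain ⟨hs, -⟩ := support_integrable_of_lt_top hf hfin
  have hnn : 0 ≤ fun p => weight η Q p * max (qForm Λ p - frob Λ Q) 0 :=
    fun p => mul_nonneg (weight_nonneg _ _ _) (le_max_right _ _)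
  have hc : Continuous fun p => weight η Q p * max (qForm Λ p - frob Λ Q) 0 :=
    (continuous_weight η Q).mul ((continuous_tilt_right Λ Q).max continuous_const)
  refine (integral_nonneg hnn).lt_of_ne' fun h0 => ?_
  have hz := (integral_eq_zero_iff_of_nonneg hnn hc.integrable_sigma).1 h0
  have hle : ∀ᵐ p ∂sigma, f p ≠ 0 → qForm Λ p - frob Λ Q ≤ 0 := by
    filter_upwards [hz, hs] with p hp hp' hfp
    have := (mul_eq_zero.1 hp).resolve_left (weight_pos_iff.2 (hp' hfp)).ne'
    exact max_eq_right_iff.1 this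
  have hint : Integrable (fun p => f p * (-frob Λ Q + qForm Λ p)) sigma :=
    integrable_mul_add_qForm hf.1.1 _ Λ
  have hzero : ∫ p, f p * (-frob Λ Q + qForm Λ p) ∂sigma = 0 := by
    rw [integral_mul_add_qForm hf.1.1, hf.1.2.2, hf.2]
    ring
  have hnp : 0 ≤ᵐ[sigma] fun p => -(f p * (-frob Λ Q + qForm Λ p)) := by
    filter_upwards [hle, hf.1.2.1] with p hp hp0
    by_cases h : f p = 0
    · simp [h]
    · have := mul_nonneg hp0 (neg_nonneg.2 (hp h))
      simp only [Pi.zero_apply]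
      linarith
  have hz' := (integral_eq_zero_iff_of_nonneg_ae hnp hint.neg).1 (by
    rw [integral_neg, hzero, neg_zero])
  have hf0 : f =ᵐ[sigma] 0 := by
    filter_upwards [hz', ae_add_qForm_ne_zero (a := -frob Λ Q) fun h => hΛ h.2] with p hp hp'
    exact (mul_eq_zero.1 (neg_eq_zero.1 hp)).resolve_right hp'
  have h1 := hf.1.2.2
  rw [integral_congr_ae hf0] at h1
  simp at h1

instance : Nontrivial Sym0 := by
  refine ⟨⟨⟨fun i j => if i = j then ![1, -1, 0] i else 0, ?_, ?_⟩, 0, fun h => ?_⟩⟩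
  · intro i j
    by_cases h : i = j
    · simp [h]
    · simp [h, Ne.symm h]
  · simp [Fin.sum_univ_three]
  · have := congrFun (congrFun (congrArg Subtype.val h) 0) 0
    simp at this

/-- Coercivity of the dual function, locally uniform in the Q-tensor. -/
theorem exists_mul_norm_le_excess {η : ℝ} {Q₀ : Sym0} (hQ : Q₀ ∈ domJ η) :
    ∃ m > 0, ∀ᶠ Q in 𝓝 Q₀, ∀ Λ, m * ‖Λ‖ ≤ excess η Q Λ := by
  have hK : IsCompact (Metric.sphere (0 : Sym0) 1) := isCompact_sphere 0 1
  obtain ⟨Λ₁, hΛ₁, hmin⟩ := hK.exists_isMinOn (NormedSpace.sphere_nonempty.2 zero_le_one)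
    ((continuous_excess η).comp (Continuous.prodMk_right Q₀)).continuousOn
  have hpos : 0 < excess η Q₀ Λ₁ := excess_pos hQ fun h => by simp [h] at hΛ₁
  refine ⟨excess η Q₀ Λ₁ / 2, half_pos hpos, ?_⟩
  have hev : ∀ᶠ Q in 𝓝 Q₀, ∀ Λ ∈ Metric.sphere (0 : Sym0) 1,
      excess η Q₀ Λ₁ / 2 ≤ excess η Q Λ := by
    refine hK.eventually_forall_of_forall_eventually fun Λ hΛ => ?_
    refine ((continuous_excess η).tendsto (Q₀, Λ)).eventually_const_le ?_
    have : excess η Q₀ Λ₁ ≤ excess η Q₀ Λ := hmin hΛ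
    change excess η Q₀ Λ₁ / 2 < excess η Q₀ Λ
    linarith
  filter_upwards [hev] with Q h Λ
  rcases eq_or_ne Λ 0 with rfl | hΛ
  · rw [norm_zero, mul_zero]
    exact integral_nonneg fun p => mul_nonneg (weight_nonneg _ _ _) (le_max_right _ _)
  · have hn : 0 < ‖Λ‖ := norm_pos_iff.2 hΛ
    have h1 := h (‖Λ‖⁻¹ • Λ) (by
      rw [mem_sphere_zero_iff_norm, norm_smul, norm_inv, norm_norm, inv_mul_cancel₀ hn.ne'])
    rw [excess_smul _ _ _ (inv_nonneg.2 hn.le), inv_mul_eq_div, le_div_iff₀ hn] at h1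
    exact h1

theorem exists_minimizer_dualFun {η m : ℝ} {Q : Sym0} (hm : 0 < m)
    (h : ∀ Λ, m * ‖Λ‖ ≤ dualFun η Q Λ) :
    ∃ Λ, ‖Λ‖ ≤ dualFun η Q 0 / m ∧ ∀ Λ', dualFun η Q Λ ≤ dualFun η Q Λ' := by
  have h0 : 0 ≤ dualFun η Q 0 := by simpa using h 0
  obtain ⟨Λ, hΛ, hmin⟩ := (isCompact_closedBall (0 : Sym0) (dualFun η Q 0 / m)).exists_isMinOn
    ⟨0, Metric.mem_closedBall_self (by positivity)⟩
    ((continuous_dualFun η).comp (Continuous.prodMk_right Q)).continuousOn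
  have hmin : ∀ Λ' ∈ Metric.closedBall (0 : Sym0) (dualFun η Q 0 / m),
      dualFun η Q Λ ≤ dualFun η Q Λ' := fun Λ' h => hmin h
  refine ⟨Λ, by simpa using hΛ, fun Λ' => ?_⟩
  by_cases hb : Λ' ∈ Metric.closedBall (0 : Sym0) (dualFun η Q 0 / m)
  · exact hmin Λ' hb
  · rw [mem_closedBall_zero_iff, not_le, div_lt_iff₀ hm, mul_comm] at hb
    exact (hmin 0 (Metric.mem_closedBall_self (by positivity))).trans (hb.le.trans (h Λ'))

/-- The Euler-Lagrange equation of the dual problem. -/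
theorem stationarity_of_minimizer {η : ℝ} {Q Λ : Sym0}
    (hmin : ∀ Λ', dualFun η Q Λ ≤ dualFun η Q Λ') (R : Sym0) :
    ∫ p, weight η Q p * Real.exp (qForm Λ p - frob Λ Q) * (qForm R p - frob R Q) ∂sigma = 0 := by
  set g : S2 → ℝ := fun p => weight η Q p * Real.exp (qForm Λ p - frob Λ Q) with hg
  set y : S2 → ℝ := fun p => qForm R p - frob R Q with hy
  have hgc : Continuous g :=
    (continuous_weight η Q).mul (Real.continuous_exp.comp (continuous_tilt_right Λ Q))
  have hyc : Continuous y := continuous_tilt_right R Q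
  have hg0 : ∀ p, 0 ≤ g p := fun p => mul_nonneg (weight_nonneg _ _ _) (Real.exp_pos _).le
  obtain ⟨C, hC⟩ := isCompact_univ.exists_bound_of_continuousOn hyc.continuousOn
  have hI1 : Integrable (fun p => g p * y p) sigma := (hgc.mul hyc).integrable_sigma
  have hI2 : Integrable (fun p => g p * y p ^ 2) sigma := (hgc.mul (hyc.pow 2)).integrable_sigma
  set I := ∫ p, g p * y p ∂sigma
  set S := ∫ p, g p * y p ^ 2 ∂sigma
  -- Since `exp s ≤ 1 + s + s²` near zero, the dual function lies below a parabola in `t`.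
  have hlow : ∀ t : ℝ, |t| * C ≤ 1 → 0 ≤ t * I + t ^ 2 * S := by
    intro t ht
    have hexp : dualFun η Q (Λ + t • R) = ∫ p, g p * Real.exp (t * y p) ∂sigma := by
      refine integral_congr_ae (.of_forall fun p => ?_)
      simp only [hg, hy, mul_assoc, ← Real.exp_add]
      congr 2
      simp only [qForm_add, qForm_smul, map_add, map_smul, LinearMap.add_apply,
        LinearMap.smul_apply, smul_eq_mul]
      ring
    have hle : ∫ p, g p * Real.exp (t * y p) ∂sigma ≤
        ∫ p, (g p + t * (g p * y p) + t ^ 2 * (g p * y p ^ 2)) ∂sigma := by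
      refine integral_mono
        (hgc.mul (Real.continuous_exp.comp (continuous_const.mul hyc))).integrable_sigma
        ((hgc.integrable_sigma.add (hI1.const_mul t)).add (hI2.const_mul (t ^ 2))) fun p => ?_
      have hb : |t * y p| ≤ 1 := by
        rw [abs_mul]
        exact (mul_le_mul_of_nonneg_left (hC p (mem_univ _)) (abs_nonneg t)).trans ht
      have := (abs_le.1 (Real.abs_exp_sub_one_sub_id_le hb)).2
      nlinarith [hg0 p]
    have h1 := integral_add (hgc.integrable_sigma.add (hI1.const_mul t)) (hI2.const_mul (t ^ 2))
    simp only [Pi.add_apply] at h1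
    rw [h1, integral_add hgc.integrable_sigma (hI1.const_mul t), integral_const_mul,
      integral_const_mul] at hle
    have h2 := hmin (Λ + t • R)
    rw [hexp] at h2
    have h3 : dualFun η Q Λ = ∫ p, g p ∂sigma := rfl
    linarith
  have hloc : IsLocalMin (fun t : ℝ => t * I + t ^ 2 * S) 0 := by
    have : ∀ᶠ t : ℝ in 𝓝 0, |t| * C ≤ 1 := by
      have hc : Tendsto (fun t : ℝ => |t| * C) (𝓝 0) (𝓝 (|0| * C)) :=
        (continuous_abs.mul continuous_const).tendsto 0
      refine hc.eventually_le_const ?_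
      simp
    filter_upwards [this] with t ht
    simpa using hlow t ht
  have hder : HasDerivAt (fun t : ℝ => t * I + t ^ 2 * S) I 0 := by
    simpa using ((hasDerivAt_id (0 : ℝ)).mul_const I).fun_add
      (((hasDerivAt_id (0 : ℝ)).fun_pow 2).mul_const S)
  exact hloc.hasDerivAt_eq_zero hder

theorem mem_admissible_gibbs {η : ℝ} {Q : Sym0} {c : ℝ} {Λ : Sym0}
    (h1 : ∫ p, gibbs η Q c Λ p ∂sigma = 1)
    (h : ∀ R, ∫ p, gibbs η Q c Λ p * qForm R p ∂sigma = frob R Q) :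
    gibbs η Q c Λ ∈ admissible Q := by
  have hi := (continuous_gibbs η Q c Λ).integrable_sigma
  refine ⟨⟨hi, .of_forall (gibbs_nonneg η Q c Λ), h1⟩, eq_of_forall_frob_eq fun R => ?_⟩
  rw [frob_qTensor hi, h]

theorem gibbs_eq_exp_mul (η : ℝ) (Q : Sym0) (c b : ℝ) (Λ : Sym0) (p : S2) :
    gibbs η Q c Λ p = Real.exp (c + b) * (weight η Q p * Real.exp (qForm Λ p - b)) := by
  rw [gibbs, mul_left_comm, ← Real.exp_add]
  ring_nf

theorem integral_weight_pos {η : ℝ} {Q : Sym0} (hQ : Q ∈ domJ η) :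
    0 < ∫ p, weight η Q p ∂sigma := by
  obtain ⟨Λ, hΛ⟩ := exists_ne (0 : Sym0)
  have h := excess_pos hQ hΛ
  refine (integral_nonneg (weight_nonneg η Q)).lt_of_ne' fun h0 => h.ne' ?_
  have hz := (integral_eq_zero_iff_of_nonneg (weight_nonneg η Q)
    (continuous_weight η Q).integrable_sigma).1 h0
  rw [excess, integral_congr_ae (g := 0) (hz.mono fun p hp => by simp [hp])]
  simp

/-- Near a point of the domain of `J` the minimisers exist, belong to the exponential family, and
have locally bounded parameters. -/
theorem eventually_exists_gibbs {η : ℝ} {Q₀ : Sym0} (hQ : Q₀ ∈ domJ η) :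
    ∃ M > 0, ∀ᶠ Q in 𝓝 Q₀, ∃ c Λ, |c| ≤ M ∧ ‖Λ‖ ≤ M ∧ gibbs η Q c Λ ∈ admissible Q := by
  obtain ⟨m, hm, hcoer⟩ := exists_mul_norm_le_excess hQ
  have hW0 := integral_weight_pos hQ
  set W : Sym0 → ℝ := fun Q => ∫ p, weight η Q p ∂sigma
  have hWc : Continuous W := continuous_integral_sigma (continuous_weight_uncurry η)
  -- The minimiser lies in the ball of radius `W Q / m ≤ N`, by coercivity and comparison with `0`.
  set N := 2 * W Q₀ / m
  have hN : 0 < N := by positivity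
  set M := 9 * N + |Real.log (W Q₀ / 2)| + |Real.log (2 * W Q₀)|
  refine ⟨M, by positivity, ?_⟩
  filter_upwards [hcoer, (hWc.tendsto Q₀).eventually_const_le (half_lt_self hW0),
    (hWc.tendsto Q₀).eventually_le_const (lt_two_mul_self hW0)] with Q hco hW1 hW2
  obtain ⟨Λ, hΛ, hmin⟩ := exists_minimizer_dualFun hm fun Λ =>
    (hco Λ).trans (excess_le_dualFun η Q Λ)
  have h00 : dualFun η Q 0 = W Q := by simp [dualFun, W, qForm_eq_frob]
  have hΛN : ‖Λ‖ ≤ N := hΛ.trans (by rw [h00]; exact div_le_div_of_nonneg_right hW2 hm.le)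
  have hstat := stationarity_of_minimizer hmin
  set Z := ∫ p, weight η Q p * Real.exp (qForm Λ p) ∂sigma
  have hint : Integrable (fun p => weight η Q p * Real.exp (qForm Λ p)) sigma :=
    ((continuous_weight η Q).mul
      (Real.continuous_exp.comp (continuous_qForm Λ))).integrable_sigma
  have hbd : ∀ p, |qForm Λ p| ≤ 9 * N := fun p =>
    (abs_qForm_le Λ p).trans (mul_le_mul_of_nonneg_left hΛN (by norm_num))
  have hwi := (continuous_weight η Q).integrable_sigma
  have hZ1 : W Q₀ / 2 * Real.exp (-(9 * N)) ≤ Z := by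
    refine (mul_le_mul_of_nonneg_right hW1 (Real.exp_pos _).le).trans ?_
    rw [← integral_mul_const]
    refine integral_mono (hwi.mul_const _) hint fun p => ?_
    exact mul_le_mul_of_nonneg_left (Real.exp_le_exp.2 (neg_le_of_abs_le (hbd p)))
      (weight_nonneg _ _ _)
  have hZ2 : Z ≤ 2 * W Q₀ * Real.exp (9 * N) := by
    refine le_trans ?_ (mul_le_mul_of_nonneg_right hW2 (Real.exp_pos _).le)
    rw [← integral_mul_const]
    refine integral_mono hint (hwi.mul_const _) fun p => ?_
    exact mul_le_mul_of_nonneg_left (Real.exp_le_exp.2 (le_of_abs_le (hbd p)))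
      (weight_nonneg _ _ _)
  have hZ : 0 < Z := lt_of_lt_of_le (by positivity) hZ1
  have hl1 := Real.log_le_log (by positivity) hZ1
  have hl2 := Real.log_le_log hZ hZ2
  rw [Real.log_mul (by positivity) (Real.exp_pos _).ne', Real.log_exp] at hl1 hl2
  have hmass : ∫ p, gibbs η Q (-Real.log Z) Λ p ∂sigma = 1 := by
    simp only [gibbs_eq_exp_mul η Q _ 0, sub_zero, add_zero]
    rw [integral_const_mul, Real.exp_neg, Real.exp_log hZ]
    exact inv_mul_cancel₀ hZ.ne'
  refine ⟨-Real.log Z, Λ, ?_, hΛN.trans ?_, mem_admissible_gibbs hmass fun R => ?_⟩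
  · rw [abs_neg, abs_le]
    constructor
    · linarith [neg_abs_le (Real.log (W Q₀ / 2)), abs_nonneg (Real.log (2 * W Q₀))]
    · linarith [le_abs_self (Real.log (2 * W Q₀)), abs_nonneg (Real.log (W Q₀ / 2))]
  · linarith [abs_nonneg (Real.log (2 * W Q₀)), abs_nonneg (Real.log (W Q₀ / 2))]
  · have hi := (continuous_gibbs η Q (-Real.log Z) Λ).integrable_sigma
    have h0 : ∫ p, gibbs η Q (-Real.log Z) Λ p * (-frob R Q + qForm R p) ∂sigma = 0 := by
      rw [← mul_zero (Real.exp (-Real.log Z + frob Λ Q)), ← hstat R, ← integral_const_mul]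
      refine integral_congr_ae (.of_forall fun p => ?_)
      simp only [gibbs_eq_exp_mul η Q _ (frob Λ Q)]
      ring
    rw [integral_mul_add_qForm hi, hmass, frob_qTensor hi] at h0
    linarith

/-! ### Regularity of the macroscopic energy -/

theorem exists_gibbs {η : ℝ} {Q : Sym0} (hQ : Q ∈ domJ η) :
    ∃ c Λ, gibbs η Q c Λ ∈ admissible Q := by
  obtain ⟨M, -, h⟩ := eventually_exists_gibbs hQ
  obtain ⟨c, Λ, -, -, hg⟩ := h.self_of_nhds
  exact ⟨c, Λ, hg⟩

theorem mem_domJ_of_gibbs {η : ℝ} {Q : Sym0} {c : ℝ} {Λ : Sym0}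
    (hg : gibbs η Q c Λ ∈ admissible Q) : Q ∈ domJ η := by
  change macroEnergy η Q < ⊤
  rw [macroEnergy_eq_of_gibbs hg]
  exact EReal.coe_lt_top _

theorem isOptimal_optimal {η : ℝ} {Q : Sym0} (hQ : Q ∈ domJ η) : IsOptimal η Q (optimal η Q) := by
  obtain ⟨c, Λ, hg⟩ := exists_gibbs hQ
  exact Classical.epsilon_spec ⟨_, isOptimal_gibbs hg⟩

theorem freeEnergy_optimal {η : ℝ} {Q : Sym0} (hQ : Q ∈ domJ η) :
    freeEnergy η (optimal η Q) = macroEnergy η Q :=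
  (macroEnergy_eq_of_isOptimal (isOptimal_optimal hQ)).symm

theorem optimal_mem_domF {η : ℝ} {Q : Sym0} (hQ : Q ∈ domJ η) : optimal η Q ∈ domF η :=
  ⟨(isOptimal_optimal hQ).1.1, (freeEnergy_optimal hQ).trans_lt hQ⟩

theorem eventually_mem_domJ {η : ℝ} {Q₀ : Sym0} (hQ : Q₀ ∈ domJ η) : ∀ᶠ Q in 𝓝 Q₀, Q ∈ domJ η := by
  obtain ⟨M, -, h⟩ := eventually_exists_gibbs hQ
  filter_upwards [h]
  rintro Q ⟨c, Λ, -, -, hg⟩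
  exact mem_domJ_of_gibbs hg

/-- Weak duality at `Q'`, with the multipliers of `Q`, bounds `J(Q) - J(Q')`. -/
theorem exists_lipschitzOnWith_macroEnergy {η : ℝ} {Q₀ : Sym0} (hQ : Q₀ ∈ domJ η) :
    ∃ C, ∃ s ∈ 𝓝 Q₀, LipschitzOnWith C (fun Q => (macroEnergy η Q).toReal) s := by
  obtain ⟨M, hM, h⟩ := eventually_exists_gibbs hQ
  set D := 9 * M + 9 * Real.exp (M + 9 * M) * sigma.real univ
  have hD : 0 ≤ D := by positivity
  refine ⟨D.toNNReal, _, h, LipschitzOnWith.of_le_add_mul _ ?_⟩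
  rintro Q ⟨c, Λ, hc, hΛ, hg⟩ Q' ⟨c', Λ', -, -, hg'⟩
  have hle := le_macroEnergy (η := η) Q' c Λ
  rw [macroEnergy_eq_of_gibbs hg'] at hle ⊢
  rw [macroEnergy_eq_of_gibbs hg, EReal.toReal_coe, EReal.toReal_coe, Real.coe_toNNReal _ hD,
    dist_eq_norm]
  rw [EReal.coe_le_coe_iff] at hle
  have h1 : frob Λ Q - frob Λ Q' ≤ 9 * M * ‖Q - Q'‖ := by
    rw [← map_sub]
    exact (le_of_abs_le (abs_frob_le _ _)).trans (by gcongr)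
  have h2 : ∫ p, gibbs η Q' c Λ p ∂sigma - 1 ≤
      9 * ‖Q - Q'‖ * Real.exp (M + 9 * M) * sigma.real univ := by
    have hsub := integral_sub (continuous_gibbs η Q' c Λ).integrable_sigma
      (continuous_gibbs η Q c Λ).integrable_sigma
    rw [hg.1.2.2] at hsub
    rw [← hsub]
    refine (Real.le_norm_self _).trans (norm_integral_le_of_norm_le_const (.of_forall fun p => ?_))
    rw [gibbs, gibbs, ← sub_mul, norm_mul, Real.norm_eq_abs, Real.norm_eq_abs, Real.abs_exp]
    refine mul_le_mul ?_ (Real.exp_le_exp.2 (add_le_add (le_of_abs_le hc) ?_)) (Real.exp_pos _).le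
      (by positivity)
    · rw [norm_sub_rev]
      exact abs_weight_sub_le η Q' Q p
    · exact (le_of_abs_le (abs_qForm_le Λ p)).trans (by gcongr)
  calc c + frob Λ Q ≤ c' + frob Λ' Q' + (9 * M * ‖Q - Q'‖ +
        9 * ‖Q - Q'‖ * Real.exp (M + 9 * M) * sigma.real univ) := by linarith
    _ = _ := by ring

/-- A locally Lipschitz function on a finite-dimensional space is Fréchet differentiable as soon as
its directional derivatives exist and are linear in the direction. -/
theorem hasFDerivAt_of_lipschitzOnWith_of_hasLineDerivAt {E : Type*} [NormedAddCommGroup E]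
    [NormedSpace ℝ E] [FiniteDimensional ℝ E] {f : E → ℝ} {C : NNReal} {s : Set E} {x : E}
    (hs : s ∈ 𝓝 x) (hf : LipschitzOnWith C f s) {L : E →L[ℝ] ℝ}
    (hL : ∀ v, HasLineDerivAt ℝ f (L v) x v) : HasFDerivAt f L x := by
  obtain ⟨g, hg, hfg⟩ := hf.extend_real
  have heq : f =ᶠ[𝓝 x] g := eventually_of_mem hs hfg
  refine HasFDerivAt.congr_of_eventuallyEq ?_ heq
  refine hg.hasFDerivAt_of_hasLineDerivAt_of_closure (s := univ) (by simp) fun v _ => ?_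
  exact (hL v).congr_of_eventuallyEq heq.symm

/-! ### Expansion of the free energy in directions of `V` -/

theorem hasDerivAt_of_abs_sub_le_sq {g : ℝ → ℝ} {d C : ℝ}
    (h : ∀ᶠ t in 𝓝 (0 : ℝ), |g t - g 0 - t * d| ≤ t ^ 2 * C) : HasDerivAt g d 0 := by
  rw [hasDerivAt_iff_isLittleO_nhds_zero]
  have h1 : (fun t : ℝ => g (0 + t) - g 0 - t • d) =O[𝓝 0] fun t => t ^ 2 :=
    Asymptotics.IsBigO.of_bound C (by
      filter_upwards [h] with t ht
      rw [zero_add, smul_eq_mul, Real.norm_eq_abs, Real.norm_eq_abs, abs_of_nonneg (sq_nonneg t),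
        mul_comm C]
      exact ht)
  exact h1.trans_isLittleO (Asymptotics.isLittleO_pow_id one_lt_two)

theorem InV.integrable {u : S2 → ℝ} (hu : InV u) : Integrable u sigma :=
  hu.1.integrable le_top

theorem InV.exists_bound {u : S2 → ℝ} (hu : InV u) : ∃ B, 0 ≤ B ∧ ∀ᵐ p ∂sigma, |u p| ≤ B := by
  refine ⟨(eLpNormEssSup u sigma).toReal, ENNReal.toReal_nonneg, ?_⟩
  have hfin : eLpNormEssSup u sigma ≠ ⊤ := by
    rw [← eLpNorm_exponent_top]
    exact hu.1.eLpNorm_ne_top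
  filter_upwards [ae_le_eLpNormEssSup (f := u) (μ := sigma)] with p hp
  have := ENNReal.toReal_mono hfin hp
  simpa using this

theorem InV.integral_mul_add_qForm {u : S2 → ℝ} (hu : InV u) (c : ℝ) (Λ : Sym0) :
    ∫ p, u p * (c + qForm Λ p) ∂sigma = 0 := by
  rw [DenseNematic.integral_mul_add_qForm hu.integrable, hu.2.1, hu.2.2]
  simp

theorem InV.add_const_mul_mem_admissible {Q : Sym0} {f u : S2 → ℝ} (hf : f ∈ admissible Q)
    (hu : InV u) {t : ℝ} (h0 : 0 ≤ᵐ[sigma] fun p => f p + t * u p) :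
    (fun p => f p + t * u p) ∈ admissible Q := by
  refine ⟨⟨hf.1.1.add (hu.integrable.const_mul t), h0, ?_⟩, ?_⟩
  · rw [integral_add hf.1.1 (hu.integrable.const_mul t), integral_const_mul, hu.2.2, hf.1.2.2]
    ring
  · rw [qTensor_add hf.1.1 (hu.integrable.const_mul t), qTensor_const_mul, hu.2.1, hf.2]
    simp

/-- The second-order Taylor estimate for `x ↦ x ln x`, valid up to the boundary. -/
theorem abs_mul_log_taylor_le {a b : ℝ} (ha : 0 < a) (hb : 0 ≤ b) :
    |b * Real.log b - a * Real.log a - (b - a) * Real.log a - (b - a)| ≤ (b - a) ^ 2 / a := by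
  rcases hb.eq_or_lt with rfl | hb
  · have : (0 - a) ^ 2 / a = a := by field_simp; ring
    rw [this]
    simp [abs_of_pos ha]
  · have h1 := Real.log_le_sub_one_of_pos (div_pos hb ha)
    have h2 := Real.log_le_sub_one_of_pos (div_pos ha hb)
    rw [Real.log_div hb.ne' ha.ne'] at h1
    rw [Real.log_div ha.ne' hb.ne'] at h2
    have h3 : (b - a) ^ 2 / a = b * (b / a) - 2 * b + a := by field_simp; ring
    have h4 : b * (a / b) = a := by field_simp
    rw [h3, abs_le]
    constructor
    · have h5 : 0 ≤ (b - a) ^ 2 / a := by positivity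
      nlinarith
    · nlinarith

theorem abs_log_le {x y z : ℝ} (hx : 0 < x) (hxy : x ≤ y) (hyz : y ≤ z) :
    |Real.log y| ≤ |Real.log x| + z := by
  have hy := hx.trans_le hxy
  have h1 := Real.log_le_log hx hxy
  have h2 := Real.log_le_sub_one_of_pos hy
  rw [abs_le]
  constructor <;> linarith [neg_abs_le (Real.log x), abs_nonneg (Real.log x)]

variable {η : ℝ} {Q : Sym0} {f u : S2 → ℝ} {δ κ B : ℝ}

theorem aestronglyMeasurable_energyDensity (η : ℝ) (Q : Sym0)
    (hf : AEStronglyMeasurable f sigma) : AEStronglyMeasurable (energyDensity η Q f) sigma := by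
  have hf' := hf.aemeasurable
  have hw := (continuous_weight η Q).measurable
  refine AEMeasurable.aestronglyMeasurable ?_
  unfold energyDensity
  fun_prop

theorem integrable_mul_log_sub_log (hf : Integrable f sigma) (hu : InV u) (hδ : 0 < δ) (hκ : 0 < κ)
    (hlow : ∀ᵐ p ∂sigma, u p ≠ 0 → δ ≤ f p)
    (hwt : ∀ᵐ p ∂sigma, u p ≠ 0 → κ ≤ weight η Q p) :
    Integrable (fun p => u p * (Real.log (f p) - Real.log (weight η Q p))) sigma := by
  obtain ⟨B, hB0, hB⟩ := hu.exists_bound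
  have hf' := hf.aestronglyMeasurable.aemeasurable
  have hu' := hu.integrable.aestronglyMeasurable.aemeasurable
  have hw := (continuous_weight η Q).measurable
  refine Integrable.mono' (g := fun p => B * (|Real.log δ| + |f p| + (|Real.log κ| +
    (9 * ‖Q‖ + |η|)))) ?_ (AEMeasurable.aestronglyMeasurable (by fun_prop)) ?_
  · exact ((((integrable_const _).add hf.abs)).add (integrable_const _)).const_mul B
  · filter_upwards [hB, hlow, hwt] with p h1 h2 h3
    rw [norm_mul, Real.norm_eq_abs, Real.norm_eq_abs]
    by_cases h0 : u p = 0
    · rw [h0, abs_zero, zero_mul]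
      positivity
    · exact mul_le_mul h1 ((abs_sub _ _).trans (add_le_add (abs_log_le hδ (h2 h0) (le_abs_self _))
        (abs_log_le hκ (h3 h0) (weight_le _ _ _)))) (abs_nonneg _) hB0

/-- Expansion of the energy along a segment in a direction of `V` supported where the density and
the weight are bounded below: the remainder is quadratic, with an explicit constant. -/
theorem energy_expansion (hf : f ∈ admissible Q) (hfin : freeEnergy η f < ⊤) (hu : InV u)
    (hδ : 0 < δ) (hκ : 0 < κ) (hB : ∀ᵐ p ∂sigma, |u p| ≤ B)
    (hlow : ∀ᵐ p ∂sigma, u p ≠ 0 → δ ≤ f p)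
    (hwt : ∀ᵐ p ∂sigma, u p ≠ 0 → κ ≤ weight η Q p) {t : ℝ} (ht : |t| * B ≤ δ) :
    (fun p => f p + t * u p) ∈ domF η ∧
      |(freeEnergy η fun p => f p + t * u p).toReal - (freeEnergy η f).toReal -
        t * ∫ p, u p * (Real.log (f p) - Real.log (weight η Q p)) ∂sigma| ≤
      t ^ 2 * (B ^ 2 / δ * sigma.real univ) := by
  obtain ⟨hs, hi⟩ := support_integrable_of_lt_top hf hfin
  have htu : ∀ᵐ p ∂sigma, |t * u p| ≤ δ := by
    filter_upwards [hB] with p hp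
    rw [abs_mul]
    exact (mul_le_mul_of_nonneg_left hp (abs_nonneg t)).trans ht
  have hnn : 0 ≤ᵐ[sigma] fun p => f p + t * u p := by
    filter_upwards [htu, hlow, hf.1.2.1] with p h1 h2 h3
    by_cases h0 : u p = 0
    · simpa [h0] using h3
    · simp only [Pi.zero_apply]
      linarith [neg_le_of_abs_le h1, h2 h0]
  have hg := InV.add_const_mul_mem_admissible hf hu hnn
  have hgs : ∀ᵐ p ∂sigma, f p + t * u p ≠ 0 → p ∈ posSet η Q := by
    filter_upwards [hs, hwt] with p h1 h2 h
    by_cases h0 : u p = 0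
    · exact h1 (by simpa [h0] using h)
    · exact weight_pos_iff.1 (hκ.trans_le (h2 h0))
  have hlin := integrable_mul_log_sub_log (Q := Q) hf.1.1 hu hδ hκ hlow hwt
  set g : S2 → ℝ := fun p => f p + t * u p with hgdef
  set l : S2 → ℝ := fun p => u p * (Real.log (f p) - Real.log (weight η Q p)) with hl
  have hrem : ∀ᵐ p ∂sigma, ‖energyDensity η Q g p - (energyDensity η Q f p + t * l p + t * u p)‖ ≤
      t ^ 2 * B ^ 2 / δ := by
    filter_upwards [hlow, hnn, hB] with p h1 h2 h3
    by_cases h0 : u p = 0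
    · have hB0 : 0 ≤ B := (abs_nonneg _).trans h3
      simp only [energyDensity, hgdef, hl, h0]
      simp only [mul_zero, add_zero, zero_mul, sub_self, norm_zero]
      positivity
    · have hfp := hδ.trans_le (h1 h0)
      refine le_trans (le_of_eq ?_) ((abs_mul_log_taylor_le hfp h2).trans ?_)
      · rw [Real.norm_eq_abs]
        congr 1
        simp only [energyDensity, hgdef, hl]
        ring
      · rw [add_sub_cancel_left, mul_pow]
        exact div_le_div₀ (by positivity)
          (mul_le_mul_of_nonneg_left (sq_le_sq.2 (h3.trans (le_abs_self B))) (sq_nonneg t)) hδ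
          (h1 h0)
  have hsum : Integrable (fun p => energyDensity η Q f p + t * l p + t * u p) sigma :=
    (hi.add (hlin.const_mul t)).add (hu.integrable.const_mul t)
  have hgi : Integrable (energyDensity η Q g) sigma := by
    have hdiff : Integrable (fun p => energyDensity η Q g p -
        (energyDensity η Q f p + t * l p + t * u p)) sigma :=
      Integrable.mono' (integrable_const (t ^ 2 * B ^ 2 / δ))
        ((aestronglyMeasurable_energyDensity η Q hg.1.1.aestronglyMeasurable).sub
          hsum.aestronglyMeasurable) hrem
    exact (hdiff.add hsum).congr (.of_forall fun p => sub_add_cancel _ _)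
  have hFg := freeEnergy_eq_integral hg hgs hgi
  have hFf := freeEnergy_eq_integral hf hs hi
  refine ⟨⟨hg.1, hFg ▸ EReal.coe_lt_top _⟩, ?_⟩
  have h1 := norm_integral_le_of_norm_le_const hrem
  have h2 := integral_add (hi.add (hlin.const_mul t)) (hu.integrable.const_mul t)
  simp only [Pi.add_apply] at h2
  rw [integral_sub hgi hsum, h2, integral_add hi (hlin.const_mul t), integral_const_mul,
    integral_const_mul, hu.2.2] at h1
  rw [hFg, hFf, EReal.toReal_coe, EReal.toReal_coe]
  refine le_trans (le_of_eq ?_) (h1.trans (le_of_eq ?_))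
  · rw [Real.norm_eq_abs]
    congr 1
    ring
  · ring

/-! ### Orthogonality to `V` -/

theorem eq_of_affine_ae_eq {S : Set S2} (hS : sigma S ≠ 0) {a a' : ℝ} {R R' : Sym0}
    (h : ∀ᵐ p ∂sigma, p ∈ S → a + qForm R p = a' + qForm R' p) : a = a' ∧ R = R' := by
  by_contra hne
  refine hS (measure_eq_zero_iff_ae_notMem.2 ?_)
  have hne' : ¬(a - a' = 0 ∧ R - R' = 0) := by rwa [sub_eq_zero, sub_eq_zero]
  filter_upwards [h, ae_add_qForm_ne_zero hne'] with p hp hp' hpS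
  apply hp'
  rw [qForm_sub]
  linarith [hp hpS]

/-- A function on a set of positive measure that is orthogonal to all elements of `V` supported in
the set is an affine function of `p ⊗ p` there: subtracting its orthogonal projection to the affine
functions, found by inverting their Gram matrix, leaves an element of `V`. -/
theorem exists_affine_of_orthogonal {S : Set S2} (hS : MeasurableSet S) (hpos : sigma S ≠ 0)
    {l : S2 → ℝ} (hl : Measurable l) {C : ℝ} (hC : ∀ p ∈ S, |l p| ≤ C)
    (h : ∀ u, InV u → (∀ p ∉ S, u p = 0) → ∫ p, u p * l p ∂sigma = 0) :
    ∃ a R, ∀ᵐ p ∂sigma, p ∈ S → l p = a + qForm R p := by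
  set e : ℝ × Sym0 → S2 → ℝ := fun x p => x.1 + qForm x.2 p with he
  have hec : ∀ x, Continuous (e x) := fun x => continuous_const.add (continuous_qForm x.2)
  have he_add : ∀ x y p, e (x + y) p = e x p + e y p := fun x y p => by
    simp only [he, Prod.fst_add, Prod.snd_add, qForm_add]
    ring
  have he_smul : ∀ (c : ℝ) x p, e (c • x) p = c * e x p := fun c x p => by
    simp only [he, Prod.smul_fst, Prod.smul_snd, qForm_smul, smul_eq_mul]
    ring
  have hint : ∀ x y, Integrable (fun p => e x p * e y p) (sigma.restrict S) := fun x y =>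
    ((hec x).mul (hec y)).integrable_sigma.integrableOn
  have hlint : ∀ x, Integrable (fun p => l p * e x p) (sigma.restrict S) := by
    intro x
    obtain ⟨D, hD⟩ := isCompact_univ.exists_bound_of_continuousOn (hec x).continuousOn
    refine Integrable.mul_bdd (c := D) ?_ (hec x).aestronglyMeasurable
      (.of_forall fun p => hD p (mem_univ _))
    exact Integrable.mono' (integrable_const C) hl.aestronglyMeasurable
      ((ae_restrict_iff' hS).2 (.of_forall hC))
  let G : ℝ × Sym0 →ₗ[ℝ] Module.Dual ℝ (ℝ × Sym0) :=
    LinearMap.mk₂ ℝ (fun x y => ∫ p in S, e x p * e y p ∂sigma)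
      (fun x x' y => by
        simp only [he_add, add_mul]
        exact integral_add (hint x y) (hint x' y))
      (fun c x y => by
        simp only [he_smul, mul_assoc]
        exact integral_const_mul _ _)
      (fun x y y' => by
        simp only [he_add, mul_add]
        exact integral_add (hint x y) (hint x y'))
      (fun c x y => by
        simp only [he_smul, mul_left_comm]
        exact integral_const_mul _ _)
  let φ : Module.Dual ℝ (ℝ × Sym0) :=
    { toFun := fun y => ∫ p in S, l p * e y p ∂sigma
      map_add' := fun y y' => by
        simp only [he_add, mul_add]
        exact integral_add (hlint y) (hlint y')
      map_smul' := fun c y => by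
        simp only [he_smul, mul_left_comm]
        exact integral_const_mul _ _ }
  have hinj : Function.Injective G := by
    refine (injective_iff_map_eq_zero G).2 fun x hx => ?_
    have h0 : ∫ p in S, e x p * e x p ∂sigma = 0 := congrArg (fun k => k x) hx
    have hz := (integral_eq_zero_iff_of_nonneg (fun p => mul_self_nonneg (e x p)) (hint x x)).1 h0
    have hz' := (ae_restrict_iff' hS).1 hz
    have := eq_of_affine_ae_eq hpos (a := x.1) (R := x.2) (a' := 0) (R' := 0) (by
      filter_upwards [hz'] with p hp hpS
      have h1 : e x p = 0 := mul_self_eq_zero.1 (hp hpS)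
      rw [qForm_eq_frob 0, map_zero, LinearMap.zero_apply, add_zero]
      exact h1)
    exact Prod.ext this.1 this.2
  obtain ⟨x, hx⟩ := (LinearMap.injective_iff_surjective_of_finrank_eq_finrank
    (Subspace.dual_finrank_eq (K := ℝ) (V := ℝ × Sym0)).symm).1 hinj φ
  have hx' : ∀ y, ∫ p in S, (l p - e x p) * e y p ∂sigma = 0 := by
    intro y
    have h1 : ∫ p in S, e x p * e y p ∂sigma = ∫ p in S, l p * e y p ∂sigma :=
      congrArg (fun k => k y) hx
    simp only [sub_mul]
    rw [integral_sub (hlint y) (hint x y), h1, sub_self]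
  -- `u` is the residual of the projection; as an element of `V` it is orthogonal to `l` as well.
  set u : S2 → ℝ := S.indicator fun p => l p - e x p with hu
  have hue : ∀ k : S2 → ℝ, ∫ p, u p * k p ∂sigma = ∫ p in S, (l p - e x p) * k p ∂sigma := by
    intro k
    rw [← integral_indicator hS]
    refine integral_congr_ae (.of_forall fun p => ?_)
    by_cases hp : p ∈ S <;> simp [hu, hp]
  obtain ⟨D, hD⟩ := isCompact_univ.exists_bound_of_continuousOn (hec x).continuousOn
  have humeas : Measurable u := (hl.sub (hec x).measurable).indicator hS
  have hutop : MemLp u ⊤ sigma := by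
    refine memLp_top_of_bound humeas.aestronglyMeasurable (|C| + D) (.of_forall fun p => ?_)
    by_cases hp : p ∈ S
    · simp only [hu, indicator_of_mem hp]
      exact (norm_sub_le _ _).trans
        (add_le_add ((hC p hp).trans (le_abs_self C)) (hD p (mem_univ _)))
    · have : 0 ≤ D := (norm_nonneg _).trans (hD p (mem_univ _))
      simp only [hu, indicator_of_notMem hp, norm_zero]
      positivity
  have hui : Integrable u sigma := hutop.integrable le_top
  have huV : InV u := by
    refine ⟨hutop, eq_of_forall_frob_eq fun R => ?_, ?_⟩
    · rw [frob_qTensor hui, map_zero, hue]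
      simpa [he] using hx' (0, R)
    · have h1 := hx' (1, 0)
      rw [← hue] at h1
      simpa [he, qForm_eq_frob] using h1
  have hl0 := h u huV fun p hp => indicator_of_notMem hp _
  rw [hue] at hl0
  have hsq : ∫ p in S, (l p - e x p) * (l p - e x p) ∂sigma = 0 := by
    have hli : Integrable (fun p => (l p - e x p) * l p) (sigma.restrict S) := by
      refine (Integrable.mono' (integrable_const ((|C| + D) * C))
        ((hl.sub (hec x).measurable).mul hl).aestronglyMeasurable
        ((ae_restrict_iff' hS).2 (.of_forall fun p hp => ?_)))
      rw [norm_mul]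
      have hD0 : 0 ≤ D := (norm_nonneg _).trans (hD p (mem_univ _))
      exact mul_le_mul ((norm_sub_le _ _).trans
        (add_le_add ((hC p hp).trans (le_abs_self C)) (hD p (mem_univ _)))) (hC p hp)
        (norm_nonneg _) (by positivity)
    have hei : Integrable (fun p => (l p - e x p) * e x p) (sigma.restrict S) := by
      simp only [sub_mul]
      exact (hlint x).sub (hint x x)
    simp only [mul_sub (_ - _)]
    rw [integral_sub hli hei, hl0, hx', sub_zero]
  have hsqi : Integrable (fun p => (l p - e x p) * (l p - e x p)) (sigma.restrict S) := by
    refine (Integrable.mono' (integrable_const ((|C| + D) * (|C| + D)))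
      ((hl.sub (hec x).measurable).mul (hl.sub (hec x).measurable)).aestronglyMeasurable
      ((ae_restrict_iff' hS).2 (.of_forall fun p hp => ?_)))
    rw [norm_mul]
    have hb := (norm_sub_le (l p) (e x p)).trans
      (add_le_add ((hC p hp).trans (le_abs_self C)) (hD p (mem_univ _)))
    exact mul_le_mul hb hb (norm_nonneg _) ((norm_nonneg _).trans hb)
  have hz := (integral_eq_zero_iff_of_nonneg (fun p => mul_self_nonneg (l p - e x p)) hsqi).1 hsq
  refine ⟨x.1, x.2, ?_⟩
  filter_upwards [(ae_restrict_iff' hS).1 hz] with p hp hpS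
  exact sub_eq_zero.1 (mul_self_eq_zero.1 (hp hpS))

/-! ### Stationary curves and critical points -/

variable {fstar : S2 → ℝ}

theorem qTensor_eq_of_curve {f : S2 → ℝ} {u₀ u : S2 → ℝ} (hQ : Q ∈ domJ η) (hu₀ : InV u₀)
    (hu : InV u) {t : ℝ} (hf : f =ᵐ[sigma] fun p => optimal η Q p + u₀ p + t * u p) :
    qTensor f = Q := by
  have hopt := (isOptimal_optimal hQ).1
  rw [qTensor_congr hf,
    qTensor_add (f := fun p => optimal η Q p + u₀ p) (hopt.1.1.add hu₀.integrable)
      (hu.integrable.const_mul t),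
    qTensor_add hopt.1.1 hu₀.integrable, qTensor_const_mul, hu.2.1, hu₀.2.1, hopt.2]
  simp

/-- If `J` is critical at `Q` then the energy is stationary along every curve through the minimiser:
near the support of `u` the minimisers `f_{Q_t}` are bounded below uniformly in `t`, so that
`F(f_{Q_t} + t u) = J(Q_t) + O(t²)`. -/
theorem hasDerivAt_of_isCriticalPoint (hopt : fstar =ᵐ[sigma] optimal η (qTensor fstar))
    (hcrit : IsCriticalPoint η (qTensor fstar)) {ε : ℝ} {f : ℝ → S2 → ℝ} (hε : 0 < ε)
    (hA : SatisfiesA1 η ε f) (h0 : f 0 =ᵐ[sigma] fstar) :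
    HasDerivAt (fun t => (freeEnergy η (f t)).toReal) 0 0 := by
  obtain ⟨Q, u₀, u, hQC, hQJ, hu₀, hu, hf, ⟨K, hK, hKE, huK⟩, -, -⟩ := hA
  have h0mem : (0 : ℝ) ∈ Ioo (-ε) ε := ⟨by linarith, hε⟩
  have hnhds : Ioo (-ε) ε ∈ 𝓝 (0 : ℝ) := isOpen_Ioo.mem_nhds h0mem
  have hQ0 : qTensor fstar = Q 0 := by
    rw [← qTensor_congr h0]
    exact qTensor_eq_of_curve (hQJ 0 h0mem) hu₀ hu (hf 0 h0mem)
  rw [hQ0] at hopt hcrit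
  have hu₀0 : ∀ᵐ p ∂sigma, u₀ p = 0 := by
    filter_upwards [hopt, h0, hf 0 h0mem] with p h1 h2 h3
    rw [h2, h1, zero_mul] at h3
    linarith
  have hQd : DifferentiableAt ℝ Q 0 := (hQC.contDiffAt hnhds).differentiableAt one_ne_zero
  have hQc : Tendsto Q (𝓝 0) (𝓝 (Q 0)) := hQd.continuousAt
  obtain ⟨M, hM, hev⟩ := eventually_exists_gibbs (hQJ 0 h0mem)
  obtain ⟨B, hB0, hB⟩ := hu.exists_bound
  obtain ⟨κ, hκ, hκK⟩ : ∃ κ > 0, ∀ p ∈ K, κ ≤ weight η (Q 0) p := by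
    rcases K.eq_empty_or_nonempty with rfl | hne
    · exact ⟨1, one_pos, by simp⟩
    · obtain ⟨p₀, hp₀, hmin⟩ := hK.exists_isMinOn hne (continuous_weight η (Q 0)).continuousOn
      exact ⟨_, weight_pos_iff.2 (hKE hp₀), fun p hp => hmin hp⟩
  -- A lower bound for `f_{Q_t}` on `K`, for all small `t`.
  set δ := κ / 2 * Real.exp (-M - 9 * M)
  have hδ : 0 < δ := by positivity
  have hJ : HasDerivAt (fun t => (macroEnergy η (Q t)).toReal) 0 0 :=
    hcrit.2.comp_hasDerivAt (0 : ℝ) hQd.hasDerivAt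
  have hclose : ∀ᶠ t in 𝓝 (0 : ℝ), 9 * ‖Q 0 - Q t‖ ≤ κ / 2 := by
    have hc : Tendsto (fun t => 9 * ‖Q 0 - Q t‖) (𝓝 0) (𝓝 (9 * ‖Q 0 - Q 0‖)) :=
      ((tendsto_const_nhds.sub hQc).norm).const_mul 9
    refine hc.eventually_le_const ?_
    simpa using hκ
  have hsmall : ∀ᶠ t in 𝓝 (0 : ℝ), |t| * B ≤ δ := by
    have hc : Tendsto (fun t : ℝ => |t| * B) (𝓝 0) (𝓝 (|0| * B)) :=
      (continuous_abs.mul continuous_const).tendsto 0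
    refine hc.eventually_le_const ?_
    simpa using hδ
  have hmain : ∀ᶠ t in 𝓝 (0 : ℝ), |(freeEnergy η (f t)).toReal - (macroEnergy η (Q t)).toReal| ≤
      t ^ 2 * (B ^ 2 / δ * sigma.real univ) := by
    filter_upwards [hnhds, hQc.eventually hev, hclose, hsmall] with t ht hg hcl hsm
    obtain ⟨c, Λ, hc, hΛ, hg⟩ := hg
    have hwt : ∀ᵐ p ∂sigma, u p ≠ 0 → κ / 2 ≤ weight η (Q t) p := by
      filter_upwards [huK] with p hp hup
      have h1 := hκK p (by_contra fun h => hup (hp h))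
      have h2 := le_of_abs_le (abs_weight_sub_le η (Q 0) (Q t) p)
      linarith
    have hlow : ∀ᵐ p ∂sigma, u p ≠ 0 → δ ≤ gibbs η (Q t) c Λ p := by
      filter_upwards [hwt] with p hp hup
      refine mul_le_mul (hp hup) (Real.exp_le_exp.2 ?_) (Real.exp_pos _).le (weight_nonneg _ _ _)
      have h1 := neg_le_of_abs_le hc
      have h2 := neg_le_of_abs_le (abs_qForm_le Λ p)
      linarith
    have hfin : freeEnergy η (gibbs η (Q t) c Λ) < ⊤ := by
      rw [freeEnergy_gibbs hg]
      exact EReal.coe_lt_top _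
    have hexp := (energy_expansion hg hfin hu hδ (half_pos hκ) hB hlow hwt hsm).2
    have hlin : ∫ p, u p * (Real.log (gibbs η (Q t) c Λ p) - Real.log (weight η (Q t) p)) ∂sigma
        = 0 := by
      rw [← hu.integral_mul_add_qForm c Λ]
      refine integral_congr_ae ?_
      filter_upwards [hwt] with p hp
      by_cases hup : u p = 0
      · simp [hup]
      · rw [log_gibbs (weight_pos_iff.1 ((half_pos hκ).trans_le (hp hup)))]
        ring
    have hft : f t =ᵐ[sigma] fun p => gibbs η (Q t) c Λ p + t * u p := by
      filter_upwards [hf t ht, optimal_ae_eq_gibbs hg, hu₀0] with p h1 h2 h3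
      rw [h1, h2, h3, add_zero]
    rw [hlin, mul_zero, sub_zero, ← freeEnergy_congr hft,
      ← macroEnergy_eq_of_isOptimal (isOptimal_gibbs hg)] at hexp
    exact hexp
  set r : ℝ → ℝ := fun t => (freeEnergy η (f t)).toReal - (macroEnergy η (Q t)).toReal with hr
  have hr0 : r 0 = 0 := by
    have := hmain.self_of_nhds
    simpa using this
  have hder : HasDerivAt r 0 0 := hasDerivAt_of_abs_sub_le_sq (by
    filter_upwards [hmain] with t ht
    simpa only [hr0, mul_zero, sub_zero] using ht)
  simpa [hr] using hder.fun_add hJ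

/-- Stationarity along the curves with constant Q-tensor: `ln f - ln (Q p · p - η)` is orthogonal to
`V` on the sets where both functions are bounded below, hence `f` belongs to the exponential family
where it is positive. -/
theorem exists_gibbs_eq_of_stationary (hfin : fstar ∈ domF η) (hQT : qTensor fstar = Q)
    (hQ : Q ∈ domJ η) {u₀ : S2 → ℝ} (hu₀ : InV u₀) (hsupp : CompactlySupportedIn u₀ (posSet η Q))
    (hdec : fstar =ᵐ[sigma] fun p => optimal η Q p + u₀ p)
    (H : ∀ (ε : ℝ) (f : ℝ → S2 → ℝ), 0 < ε → SatisfiesA1 η ε f → f 0 =ᵐ[sigma] fstar →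
      HasDerivAt (fun t => (freeEnergy η (f t)).toReal) 0 0) :
    ∃ c Λ, ∀ᵐ p ∂sigma, fstar p ≠ 0 → fstar p = gibbs η Q c Λ p := by
  have hadm : fstar ∈ admissible Q := ⟨hfin.1, hQT⟩
  obtain ⟨hs, -⟩ := support_integrable_of_lt_top hadm hfin.2
  obtain ⟨C, hC⟩ : ∃ C, ∀ᵐ p ∂sigma, fstar p ≤ C := by
    obtain ⟨c, Λ, hg⟩ := exists_gibbs hQ
    obtain ⟨C, hC⟩ := isCompact_univ.exists_bound_of_continuousOn
      (continuous_gibbs η Q c Λ).continuousOn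
    obtain ⟨B, -, hB⟩ := hu₀.exists_bound
    refine ⟨C + B, ?_⟩
    filter_upwards [hdec, optimal_ae_eq_gibbs hg, hB] with p h1 h2 h3
    rw [h1, h2]
    exact add_le_add (le_of_abs_le (hC p (mem_univ _))) (le_of_abs_le h3)
  obtain ⟨g, hgm, hg⟩ : ∃ g : S2 → ℝ, Measurable g ∧ fstar =ᵐ[sigma] g :=
    ⟨_, hfin.1.1.aestronglyMeasurable.stronglyMeasurable_mk.measurable,
      hfin.1.1.aestronglyMeasurable.ae_eq_mk⟩
  have hwm := (continuous_weight η Q).measurable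
  set l : S2 → ℝ := fun p => Real.log (g p) - Real.log (weight η Q p) with hl
  have hlm : Measurable l := by fun_prop
  -- These sets exhaust `{fstar ≠ 0}` up to a null set, and `l` is bounded on each of them.
  set S : ℕ → Set S2 := fun n =>
    {p | 1 / ((n : ℝ) + 1) ≤ g p ∧ 1 / ((n : ℝ) + 1) ≤ weight η Q p ∧ g p ≤ C} with hSdef
  have hSm : ∀ n, MeasurableSet (S n) := fun n =>
    (measurableSet_le measurable_const hgm).inter
      ((measurableSet_le measurable_const hwm).inter (measurableSet_le hgm measurable_const))
  have hlb : ∀ n, ∀ p ∈ S n, |l p| ≤ |Real.log (1 / ((n : ℝ) + 1))| + C +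
      (|Real.log (1 / ((n : ℝ) + 1))| + (9 * ‖Q‖ + |η|)) := fun n p hp =>
    (abs_sub _ _).trans (add_le_add (abs_log_le (by positivity) hp.1 hp.2.2)
      (abs_log_le (by positivity) hp.2.1 (weight_le _ _ _)))
  have horth : ∀ n, ∀ u, InV u → (∀ p ∉ S n, u p = 0) → ∫ p, u p * l p ∂sigma = 0 := by
    intro n u hu huS
    obtain ⟨B, hB0, hB⟩ := hu.exists_bound
    set δ : ℝ := 1 / ((n : ℝ) + 1)
    have hδ : 0 < δ := by positivity
    have hlow : ∀ᵐ p ∂sigma, u p ≠ 0 → δ ≤ fstar p := by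
      filter_upwards [hg] with p hp hup
      rw [hp]
      exact (by_contra fun h => hup (huS p h) : p ∈ S n).1
    have hwt : ∀ᵐ p ∂sigma, u p ≠ 0 → δ ≤ weight η Q p :=
      .of_forall fun p hup => (by_contra fun h => hup (huS p h) : p ∈ S n).2.1
    have hexp := fun t => energy_expansion (t := t) hadm hfin.2 hu hδ hδ hB hlow hwt
    set ε := δ / (B + 1)
    have hε : 0 < ε := by positivity
    have hsmall : ∀ t ∈ Ioo (-ε) ε, |t| * B ≤ δ := by
      intro t ht
      have h1 : |t| < δ / (B + 1) := abs_lt.2 ht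
      rw [lt_div_iff₀ (by positivity)] at h1
      nlinarith [abs_nonneg t]
    set f : ℝ → S2 → ℝ := fun t p => optimal η Q p + u₀ p + t * u p with hf
    have hft : ∀ t, (fun p => fstar p + t * u p) =ᵐ[sigma] f t := fun t => by
      filter_upwards [hdec] with p hp
      rw [hp]
    have hA : SatisfiesA1 η ε f := by
      refine ⟨fun _ => Q, u₀, u, contDiffOn_const, fun _ _ => hQ, hu₀, hu, fun t _ => ae_eq_rfl,
        ⟨{p | δ ≤ weight η Q p}, ?_, ?_, ?_⟩, hsupp, fun t ht =>
        domF_congr (hexp t (hsmall t ht)).1 (hft t)⟩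
      · exact (isClosed_le continuous_const (continuous_weight η Q)).isCompact
      · exact fun p hp => weight_pos_iff.1 (hδ.trans_le hp)
      · exact .of_forall fun p hp => huS p fun h => hp h.2.1
    have hf0 : f 0 =ᵐ[sigma] fstar := by
      have := (hft 0).symm
      simpa only [zero_mul, add_zero] using this
    have hder := H ε f hε hA hf0
    have hder' : HasDerivAt (fun t => (freeEnergy η (f t)).toReal)
        (∫ p, u p * (Real.log (fstar p) - Real.log (weight η Q p)) ∂sigma) 0 := by
      refine hasDerivAt_of_abs_sub_le_sq (C := B ^ 2 / δ * sigma.real univ) ?_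
      filter_upwards [isOpen_Ioo.mem_nhds (⟨by linarith, hε⟩ : (0 : ℝ) ∈ Ioo (-ε) ε)] with t ht
      have := (hexp t (hsmall t ht)).2
      rwa [freeEnergy_congr (hft t), ← freeEnergy_congr hf0] at this
    rw [← hder'.unique hder]
    refine integral_congr_ae ?_
    filter_upwards [hg] with p hp
    simp only [hl, hp]
  have hmono : Monotone S := fun m n hmn p hp =>
    ⟨(Nat.one_div_le_one_div hmn).trans hp.1, (Nat.one_div_le_one_div hmn).trans hp.2.1, hp.2.2⟩
  have hexh : ∀ᵐ p ∂sigma, fstar p ≠ 0 → ∃ n, p ∈ S n := by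
    filter_upwards [hs, hfin.1.2.1, hC, hg] with p h1 h2 h3 h4 h5
    obtain ⟨n, hn⟩ := exists_nat_one_div_lt (lt_min (lt_of_le_of_ne h2 (Ne.symm h5))
      (weight_pos_iff.2 (h1 h5)))
    rw [lt_min_iff] at hn
    exact ⟨n, h4 ▸ hn.1.le, hn.2.le, h4 ▸ h3⟩
  obtain ⟨N, hN⟩ : ∃ N, sigma (S N) ≠ 0 := by
    by_contra! hall
    have hz : fstar =ᵐ[sigma] 0 := by
      filter_upwards [hexh, ae_all_iff.2 fun n => measure_eq_zero_iff_ae_notMem.1 (hall n)]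
        with p h1 h2
      by_contra h
      obtain ⟨n, hn⟩ := h1 h
      exact h2 n hn
    have h1 := hfin.1.2.2
    rw [integral_congr_ae hz] at h1
    simp at h1
  have haff : ∀ n, N ≤ n → ∃ a R, ∀ᵐ p ∂sigma, p ∈ S n → l p = a + qForm R p := fun n hn =>
    exists_affine_of_orthogonal (hSm n)
      (fun h => hN (measure_mono_null (hmono hn) h)) hlm (hlb n) (horth n)
  obtain ⟨a, R, haR⟩ := haff N le_rfl
  have hall : ∀ n, ∀ᵐ p ∂sigma, p ∈ S n → l p = a + qForm R p := by
    intro n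
    obtain ⟨a', R', h'⟩ := haff (max n N) (le_max_right _ _)
    -- The affine functions found on different sets agree on `S N`, hence are the same.
    have heq := eq_of_affine_ae_eq hN (a := a) (R := R) (a' := a') (R' := R') (by
      filter_upwards [haR, h'] with p h1 h2 hp
      rw [← h1 hp, h2 (hmono (le_max_right _ _) hp)])
    filter_upwards [h'] with p hp hpS
    rw [heq.1, heq.2]
    exact hp (hmono (le_max_left _ _) hpS)
  refine ⟨a, R, ?_⟩
  filter_upwards [hexh, ae_all_iff.2 hall, hg] with p h1 h2 h3 h4
  obtain ⟨n, hn⟩ := h1 h4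
  have hgp : 0 < g p := lt_of_lt_of_le (by positivity) hn.1
  have hwp : 0 < weight η Q p := lt_of_lt_of_le (by positivity) hn.2.1
  rw [h3, gibbs, ← h2 n hn, Real.exp_sub, Real.exp_log hgp, Real.exp_log hwp]
  field_simp

instance : PreconnectedSpace S2 := by
  refine isPreconnected_iff_preconnectedSpace.1 (isPreconnected_sphere ?_ _ _)
  rw [← Module.finrank_eq_rank, finrank_euclideanSpace_fin]
  norm_num

/-- If `E_Q` is not the whole sphere then `f` agrees with `f_Q` on a nonempty open subset of `E_Q`,
which fixes the parameters of the exponential family. -/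
theorem ae_eq_optimal_of_gibbs_eq (hfin : fstar ∈ domF η) (hQT : qTensor fstar = Q)
    (hQ : Q ∈ domJ η) {u₀ : S2 → ℝ} (hsupp : CompactlySupportedIn u₀ (posSet η Q))
    (hdec : fstar =ᵐ[sigma] fun p => optimal η Q p + u₀ p)
    (hpos : posSet η Q = univ → ∀ᵐ p ∂sigma, 0 < fstar p)
    {c : ℝ} {Λ : Sym0} (h : ∀ᵐ p ∂sigma, fstar p ≠ 0 → fstar p = gibbs η Q c Λ p) :
    fstar =ᵐ[sigma] optimal η Q := by
  have hadm : fstar ∈ admissible Q := ⟨hfin.1, hQT⟩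
  by_cases hE : posSet η Q = univ
  · have heq : fstar =ᵐ[sigma] gibbs η Q c Λ := by
      filter_upwards [h, hpos hE] with p h1 h2 using h1 h2.ne'
    have hg : gibbs η Q c Λ ∈ admissible Q := ⟨hfin.1.congr heq, by rw [← qTensor_congr heq, hQT]⟩
    exact heq.trans (optimal_ae_eq_gibbs hg).symm
  · obtain ⟨c₀, Λ₀, hg⟩ := exists_gibbs hQ
    have hopt := optimal_ae_eq_gibbs hg
    obtain ⟨K, hK, hKE, huK⟩ := hsupp
    have hU : IsOpen (posSet η Q \ K) := (isOpen_posSet η Q).sdiff hK.isClosed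
    -- Otherwise `E_Q = K` would be clopen in the connected sphere.
    have hne : (posSet η Q \ K).Nonempty := by
      by_contra hempty
      rw [not_nonempty_iff_eq_empty, sdiff_eq_empty] at hempty
      have hEK : posSet η Q = K := hempty.antisymm hKE
      have hclopen : IsClopen (posSet η Q) := ⟨hEK ▸ hK.isClosed, isOpen_posSet η Q⟩
      rcases isClopen_iff.1 hclopen with h1 | h1
      · have hz : gibbs η Q c₀ Λ₀ = 0 := by
          funext p
          refine le_antisymm (not_lt.1 fun hp => ?_) (gibbs_nonneg _ _ _ _ _)
          simpa [h1] using gibbs_pos_iff.1 hp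
        have h2 := hg.1.2.2
        simp [hz] at h2
      · exact hE h1
    have heq := eq_of_affine_ae_eq (hU.measure_ne_zero sigma hne) (a := c) (R := Λ) (a' := c₀)
      (R' := Λ₀) (by
        filter_upwards [h, hdec, hopt, huK] with p h1 h2 h3 h4 hp
        rw [h3, h4 hp.2, add_zero] at h2
        have hp0 : 0 < gibbs η Q c₀ Λ₀ p := gibbs_pos_iff.2 hp.1
        have h5 := h1 (h2 ▸ hp0.ne')
        rw [h2] at h5
        have h6 := congrArg Real.log h5
        rw [log_gibbs hp.1, log_gibbs hp.1] at h6
        linarith)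
    rw [heq.1, heq.2] at h
    -- Thus `f ≤ f_Q`, and both have integral one.
    have hle : 0 ≤ᵐ[sigma] fun p => gibbs η Q c₀ Λ₀ p - fstar p := by
      filter_upwards [h] with p hp
      by_cases h0 : fstar p = 0
      · simpa [h0] using gibbs_nonneg η Q c₀ Λ₀ p
      · simp [← hp h0]
    have hz := (integral_eq_zero_iff_of_nonneg_ae hle (hg.1.1.sub hfin.1.1)).1 (by
      rw [integral_sub hg.1.1 hfin.1.1, hg.1.2.2, hfin.1.2.2, sub_self])
    filter_upwards [hz, hopt] with p h1 h2
    rw [h2]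
    exact (sub_eq_zero.1 h1).symm

/-- Stationarity along the curves `f_{Q + t R}` gives vanishing directional derivatives of `J`, and
`J` is locally Lipschitz. -/
theorem isCriticalPoint_of_stationary (hQ : Q ∈ domJ η) (hopt : fstar =ᵐ[sigma] optimal η Q)
    (H : ∀ (ε : ℝ) (f : ℝ → S2 → ℝ), 0 < ε → SatisfiesA1 η ε f → f 0 =ᵐ[sigma] fstar →
      HasDerivAt (fun t => (freeEnergy η (f t)).toReal) 0 0) : IsCriticalPoint η Q := by
  refine ⟨hQ, ?_⟩
  obtain ⟨C, s, hs, hlip⟩ := exists_lipschitzOnWith_macroEnergy hQ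
  refine hasFDerivAt_of_lipschitzOnWith_of_hasLineDerivAt hs hlip fun R => ?_
  have hline : ContDiff ℝ 1 fun t : ℝ => Q + t • R := by fun_prop
  have hev : ∀ᶠ t : ℝ in 𝓝 0, Q + t • R ∈ domJ η := by
    refine (hline.continuous.tendsto 0).eventually ?_
    simpa using eventually_mem_domJ hQ
  obtain ⟨ε, hε, hball⟩ := Metric.eventually_nhds_iff.1 hev
  have hJ : ∀ t ∈ Ioo (-ε) ε, Q + t • R ∈ domJ η := fun t ht =>
    hball (by rw [Real.dist_eq, sub_zero]; exact abs_lt.2 ht)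
  have hV0 : InV fun _ => 0 := ⟨MemLp.zero', by simp [qTensor], by simp⟩
  have hc0 : ∀ E : Set S2, CompactlySupportedIn (fun _ => 0) E := fun E =>
    ⟨∅, isCompact_empty, empty_subset _, .of_forall fun _ _ => rfl⟩
  have hder := H ε (fun t => optimal η (Q + t • R)) hε
    ⟨fun t => Q + t • R, fun _ => 0, fun _ => 0, hline.contDiffOn, hJ, hV0, hV0,
      fun t _ => .of_forall fun p => by simp, hc0 _, hc0 _, fun t ht => optimal_mem_domF (hJ t ht)⟩
    (by simpa using hopt.symm)
  refine HasDerivAt.congr_of_eventuallyEq hder ?_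
  filter_upwards [hev] with t ht
  rw [freeEnergy_optimal ht]

end

end DenseNematic

theorem mainTheorem7 (η : ℝ) (fstar : DenseNematic.S2 → ℝ)
    (hfin : fstar ∈ DenseNematic.domF η)
    (hcurve : ∃ ε : ℝ, 0 < ε ∧ ∃ f : ℝ → DenseNematic.S2 → ℝ,
      DenseNematic.SatisfiesA1 η ε f ∧ f 0 =ᵐ[DenseNematic.sigma] fstar)
    (hpos : DenseNematic.posSet η (DenseNematic.qTensor fstar) = Set.univ →
      ∀ᵐ p ∂DenseNematic.sigma, 0 < fstar p) :
    (∀ (ε : ℝ) (f : ℝ → DenseNematic.S2 → ℝ), 0 < ε → DenseNematic.SatisfiesA1 η ε f →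
        f 0 =ᵐ[DenseNematic.sigma] fstar →
        HasDerivAt (fun t => (DenseNematic.freeEnergy η (f t)).toReal) 0 0) ↔
      (fstar =ᵐ[DenseNematic.sigma]
          DenseNematic.optimal η (DenseNematic.qTensor fstar) ∧
        DenseNematic.IsCriticalPoint η (DenseNematic.qTensor fstar)) := by
  refine ⟨fun H => ?_, fun ⟨hopt, hcrit⟩ ε f hε hA h0 =>
    DenseNematic.hasDerivAt_of_isCriticalPoint hopt hcrit hε hA h0⟩
  obtain ⟨ε, hε, f, ⟨Q, u₀, u, -, hQJ, hu₀, hu, hf, -, hsupp, -⟩, h0⟩ := hcurve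
  have h0mem : (0 : ℝ) ∈ Set.Ioo (-ε) ε := ⟨by linarith, hε⟩
  have hQT : DenseNematic.qTensor fstar = Q 0 := by
    rw [← DenseNematic.qTensor_congr h0]
    exact DenseNematic.qTensor_eq_of_curve (hQJ 0 h0mem) hu₀ hu (hf 0 h0mem)
  have hdec : fstar =ᵐ[DenseNematic.sigma] fun p => DenseNematic.optimal η (Q 0) p + u₀ p := by
    refine h0.symm.trans ((hf 0 h0mem).trans ?_)
    simp
  rw [hQT] at hpos ⊢
  obtain ⟨c, Λ, hg⟩ := DenseNematic.exists_gibbs_eq_of_stationary hfin hQT (hQJ 0 h0mem) hu₀ hsupp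
    hdec H
  have hopt := DenseNematic.ae_eq_optimal_of_gibbs_eq hfin hQT (hQJ 0 h0mem) hsupp hdec hpos hg
  exact ⟨hopt, DenseNematic.isCriticalPoint_of_stationary (hQJ 0 h0mem) hopt H⟩
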